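/- **Setting.** There are $K\ge 1$ arms and a horizon of $T$ rounds; arm $i$ has a reward distribution $\nu_i$ supported in $[0,1]$ with mean $\mu_i$, and $\mathcal V$ is the set of all such $K$-tuples $\boldsymbol\nu=(\nu_1,\dots,\nu_K)$. The $n$-th pull of arm $i$ yields $U^i_n$, where the $U^i_n$ are independent and $U^i_n\sim\nu_i$. A policy chooses the arm of each round as a function of the arms played and rewards observed so far. Let $\mathcal R_T(\pi,\boldsymbol\nu)=\mathrm E\big[\max_i \overline U^i_T\big]$, where $\overline U^i_T$ is the cumulative reward collected from arm $i$ in $T$ rounds under $\pi$, and let $\mathrm{Reg}_T(\pi,\boldsymbol\nu)=\sup_{\pi'}\mathcal R_T(\pi',\boldsymbol\nu)-\mathcal R_T(\pi,\boldsymbol\nu)$, the supremum being over all policies. **The policy $\mathrm{ADA\text{-}ETC}_{K,T}$.** Let $\tau=\lceil T^{2/3}/K^{2/3}\rceil$, let $\bar\mu^i_n=\frac1n\sum_{s=1}^n U^i_s$, and for $n\ge1$ put $$\mathrm{UCB}^i_n=\bar\mu^i_n+\sqrt{\tfrac4n\log\Big(\tfrac{T}{Kn^{3/2}}\Big)}\,\mathbf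 1_{\{n<\tau\}},\qquad \mathrm{LCB}^i_n=\bar\mu^i_n-\bar\mu^i_n\mathbf 1_{\{n<\tau\}}.$$ Let $n^i_t$ be the number of pulls of arm $i$ up to and including round $t$. In rounds $1,\dots,K$ each arm is pulled once. In each round $t>K$ of the Explore phase, let $L_t\in\arg\max_i \mathrm{LCB}^i_{n^i_{t-1}}$ and $E_t\in\arg\max_i \mathrm{UCB}^i_{n^i_{t-1}}$, ties being broken arbitrarily (as a function of the history). If $\mathrm{LCB}^{L_t}_{n^{L_t}_{t-1}}>\max_{i\ne L_t}\mathrm{UCB}^i_{n^i_{t-1}}$, the policy commits to $L_t$. Otherwise, if $E_t$ has already been pulled at least $\tau$ times (which can only happen when the two sides of this test are equal), it commits to $E_t$; otherwise it pulls $E_t$ and continues to explore. Once it has committed to an arm, it pulls that arm in all rounds up to $T$. **Theorem.** Let $K<T$, and let ties be broken in any way. (i) Let $\boldsymbol\nu\in\mathcal V$ have a unique optimal arm, relabel the arms so that $\mu_1>\mu_2\ge\dots\ge\mu_K$, and put $\Delta_i=\mu_1-\mu_i$ and $\log^+(a)=\log(\max(a,1))$. Then $$\begin{aligned}\mathrm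{Reg}_T(\mathrm{ADA\text{-}ETC}_{K,T},\boldsymbol\nu)\le{}&\mu_1\sum_{i=2}^K\min\Big(\frac{10}{\Delta_i^2}+\frac{16}{\Delta_i^2}\log^+\Big(\frac{T\Delta_i^3}{K}\Big)+\frac{24}{\Delta_i^2}\sqrt{\log^+\Big(\frac{T\Delta_i^3}{K}\Big)},\,\tau\Big)+\mu_1\tau\sum_{i=2}^K\min\Big(2,\frac{648K}{T\Delta_i^3}\Big)\\&+\sum_{i=2}^K\exp\Big(-\frac{\tau\Delta_i^2}{2}\Big)T\Delta_i+\sum_{i=2}^K\min\Big(1,\frac{320K}{T\Delta_i^3}\Big)T(\Delta_i-\Delta_{i-1}).\end{aligned}$$ (ii) There is an absolute constant $C$, independent of $K$, $T$ and the tie-breaking, such that $$\sup_{\boldsymbol\nu\in\mathcal V}\mathrm{Reg}_T(\mathrm{ADA\text{-}ETC}_{K,T},\boldsymbol\nu)\le C\,K^{1/3}T^{2/3}\sqrt{\log K}.$$ -/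

import Mathlib

open MeasureTheory

namespace Bandit

/-! ### Stochastic bandits with `K` arms -/

/-- Histories of `t` completed rounds: the arm played and the reward observed in each of them. -/
abbrev History (K t : ℕ) : Type := Fin t → Fin K × ℝ

/-- A policy maps every history to the arm played next (measurably, so that expectations make
sense). `arm t` is used in round `t + 1`; for a horizon `T` only `arm 0, …, arm (T - 1)` are used. -/
structure Policy (K : ℕ) where
  arm : (t : ℕ) → History K t → Fin K
  measurable_arm : ∀ t, Measurable (arm t)

/-- The number of times arm `i` has been played. -/
def count {K t : ℕ} (h : History K t) (i : Fin K) : ℕ :=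
  (Finset.univ.filter fun s => (h s).1 = i).card

/-- The cumulative reward obtained from arm `i`. -/
def total {K t : ℕ} (h : History K t) (i : Fin K) : ℝ :=
  ∑ s, if (h s).1 = i then (h s).2 else 0

/-- The history produced by a policy on a table of rewards, where `u (i, n)` is the reward of the
`(n + 1)`-st pull of arm `i`. -/
def run {K : ℕ} (π : Policy K) (u : Fin K × ℕ → ℝ) : (t : ℕ) → History K t
  | 0 => Fin.elim0
  | t + 1 =>
    Fin.snoc (α := fun _ => Fin K × ℝ) (run π u t)
      (π.arm t (run π u t), u (π.arm t (run π u t), count (run π u t) (π.arm t (run π u t))))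

/-- The law of the reward table: all entries independent, those of arm `i` distributed as `ν i`. -/
noncomputable def tableLaw {K : ℕ} (ν : Fin K → ProbabilityMeasure ℝ) :
    Measure (Fin K × ℕ → ℝ) :=
  Measure.infinitePi fun p : Fin K × ℕ => (ν p.1 : Measure ℝ)

/-- The class of all `K`-tuples of reward distributions supported in `[0, 1]`. -/
def instances (K : ℕ) : Set (Fin K → ProbabilityMeasure ℝ) :=
  {ν | ∀ i, ∀ᵐ x ∂(ν i : Measure ℝ), x ∈ Set.Icc (0 : ℝ) 1}

/-- The mean reward of arm `i`. -/
noncomputable def mean {K : ℕ} (ν : Fin K → ProbabilityMeasure ℝ) (i : Fin K) : ℝ :=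
  ∫ x, x ∂(ν i : Measure ℝ)

/-- The expected value of the largest cumulative reward across arms after `T` rounds. -/
noncomputable def maxReward {K : ℕ} (T : ℕ) (π : Policy K) (ν : Fin K → ProbabilityMeasure ℝ) :
    ℝ :=
  ∫ u, ⨆ i : Fin K, total (run π u T) i ∂(tableLaw ν)

/-- The regret of a policy for the max objective with horizon `T`. -/
noncomputable def regret {K : ℕ} (T : ℕ) (π : Policy K) (ν : Fin K → ProbabilityMeasure ℝ) : ℝ :=
  (⨆ π' : Policy K, maxReward T π' ν) - maxReward T π ν

/-! ### The policy ADA-ETC -/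

/-- `τ = ⌈T^(2/3) / K^(2/3)⌉`. -/
noncomputable def tau (K T : ℕ) : ℕ :=
  ⌈(T : ℝ) ^ (2 / 3 : ℝ) / (K : ℝ) ^ (2 / 3 : ℝ)⌉₊

/-- The empirical mean of arm `i`. -/
noncomputable def empMean {K t : ℕ} (h : History K t) (i : Fin K) : ℝ :=
  total h i / (count h i : ℝ)

/-- The upper confidence bound of arm `i`. -/
noncomputable def ucb {K : ℕ} (T : ℕ) {t : ℕ} (h : History K t) (i : Fin K) : ℝ :=
  empMean h i +
    if count h i < tau K T then
      Real.sqrt (4 / (count h i : ℝ) *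
        Real.log ((T : ℝ) / ((K : ℝ) * (count h i : ℝ) ^ (3 / 2 : ℝ))))
    else 0

/-- The lower confidence bound of arm `i`. -/
noncomputable def lcb {K : ℕ} (T : ℕ) {t : ℕ} (h : History K t) (i : Fin K) : ℝ :=
  empMean h i - if count h i < tau K T then empMean h i else 0

/-- The set of maximizers of `f`. -/
noncomputable def argmax {K : ℕ} (f : Fin K → ℝ) : Finset (Fin K) :=
  Finset.univ.filter fun i => ∀ j, f j ≤ f i

/-- A rule for breaking ties: it selects an element of a given nonempty set of arms, in any
(measurable) way that may depend on the history. -/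
structure TieRule (K : ℕ) where
  choose : (t : ℕ) → History K t → Finset (Fin K) → Fin K
  choose_mem : ∀ t h S, S.Nonempty → choose t h S ∈ S
  measurable_choose : ∀ t S, Measurable fun h => choose t h S

/-- The arm `L` with the highest lower confidence bound. -/
noncomputable def lcbArm {K : ℕ} (T : ℕ) (tie : TieRule K) (t : ℕ) (h : History K t) : Fin K :=
  tie.choose t h (argmax (lcb T h))

/-- The arm `E` with the highest upper confidence bound. -/
noncomputable def ucbArm {K : ℕ} (T : ℕ) (tie : TieRule K) (t : ℕ) (h : History K t) : Fin K :=
  tie.choose t h (argmax (ucb T h))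

open Classical in
/-- The test made in the Explore phase before round `t + 1`: `some i` means that the Commit phase
starts, with arm `i`. After the `K` initial rounds the policy commits to `L` if its lower
confidence bound exceeds the upper confidence bounds of all other arms. Otherwise it would explore
`E`, but an arm that already has `τ` pulls (which can be `E` only in case of an exact tie) is not
explored any further: the policy then commits to `E`. -/
noncomputable def commitTest {K : ℕ} (T : ℕ) (tieL tieE : TieRule K) (t : ℕ) (h : History K t) :
    Option (Fin K) :=
  if t < K then none
  else if ∀ i, i ≠ lcbArm T tieL t h → ucb T h i < lcb T h (lcbArm T tieL t h) then
    some (lcbArm T tieL t h)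
  else if tau K T ≤ count h (ucbArm T tieE t h) then some (ucbArm T tieE t h)
  else none

/-- The phase in round `t + 1`: `none` is Explore, `some i` is Commit with arm `i`. -/
noncomputable def phase {K : ℕ} (T : ℕ) (tieL tieE : TieRule K) :
    (t : ℕ) → History K t → Option (Fin K)
  | 0, _ => none
  | t + 1, h => (phase T tieL tieE t fun s => h s.castSucc).or (commitTest T tieL tieE (t + 1) h)

/-- The arm played by ADA-ETC in round `t + 1`: the committed arm in the Commit phase; in the
Explore phase each arm once in the first `K` rounds, and then the arm `E`. -/
noncomputable def adaArm {K : ℕ} (T : ℕ) (tieL tieE : TieRule K) (t : ℕ) (h : History K t) :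
    Fin K :=
  match phase T tieL tieE t h with
  | some i => i
  | none => if ht : t < K then ⟨t, ht⟩ else ucbArm T tieE t h

/-! Measurability of ADA-ETC. -/

theorem measurable_count {K t : ℕ} (i : Fin K) :
    Measurable fun h : History K t => count h i := by
  have : (fun h : History K t => count h i) =
      fun h => ∑ s, if (h s).1 = i then 1 else 0 := by
    funext h
    exact Finset.card_filter _ _
  rw [this]
  refine Finset.measurable_sum _ fun s _ => ?_
  exact Measurable.ite ((measurable_fst.comp (measurable_pi_apply s)) (measurableSet_singleton i))
    measurable_const measurable_const

theorem measurable_total {K t : ℕ} (i : Fin K) :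
    Measurable fun h : History K t => total h i := by
  refine Finset.measurable_sum _ fun s _ => ?_
  exact Measurable.ite ((measurable_fst.comp (measurable_pi_apply s)) (measurableSet_singleton i))
    (measurable_snd.comp (measurable_pi_apply s)) measurable_const

theorem measurable_empMean {K t : ℕ} (i : Fin K) :
    Measurable fun h : History K t => empMean h i :=
  (measurable_total i).div (measurable_from_top.comp (measurable_count i))

theorem measurable_ucb {K T t : ℕ} (i : Fin K) :
    Measurable fun h : History K t => ucb T h i := by
  refine (measurable_empMean i).add ?_
  exact (measurable_from_top (f := fun n : ℕ => if n < tau K T then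
      Real.sqrt (4 / (n : ℝ) * Real.log ((T : ℝ) / ((K : ℝ) * (n : ℝ) ^ (3 / 2 : ℝ))))
    else 0)).comp (measurable_count i)

theorem measurable_lcb {K T t : ℕ} (i : Fin K) :
    Measurable fun h : History K t => lcb T h i := by
  refine (measurable_empMean i).sub ?_
  exact Measurable.ite ((measurable_count i) (MeasurableSet.of_discrete (s := Set.Iio (tau K T))))
    (measurable_empMean i) measurable_const

theorem measurableSet_argmax {K t : ℕ} (f : History K t → Fin K → ℝ)
    (hf : ∀ i, Measurable fun h => f h i) (S : Finset (Fin K)) :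
    MeasurableSet {h | argmax (f h) = S} := by
  have : {h | argmax (f h) = S} = ⋂ i, {h | (∀ j, f h j ≤ f h i) ↔ i ∈ S} := by
    ext h
    simp [argmax, Finset.ext_iff]
  rw [this]
  refine MeasurableSet.iInter fun i => ?_
  have hm : MeasurableSet {h | ∀ j, f h j ≤ f h i} := by
    rw [Set.ofPred_forall]
    exact MeasurableSet.iInter fun j => measurableSet_le (hf j) (hf i)
  by_cases hi : i ∈ S
  · simpa [hi] using hm
  · simpa [hi, Set.compl_def] using hm.compl

theorem measurable_tie {K t : ℕ} (tie : TieRule K) (f : History K t → Fin K → ℝ)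
    (hf : ∀ i, Measurable fun h => f h i) :
    Measurable fun h => tie.choose t h (argmax (f h)) := by
  refine measurable_to_countable' fun i => ?_
  have : (fun h => tie.choose t h (argmax (f h))) ⁻¹' {i} =
      ⋃ S, {h | argmax (f h) = S} ∩ (fun h => tie.choose t h S) ⁻¹' {i} := by
    ext h
    simp
  rw [this]
  exact MeasurableSet.iUnion fun S => (measurableSet_argmax f hf S).inter
    (tie.measurable_choose t S (measurableSet_singleton i))

theorem measurable_eval {K t : ℕ} {α : Type*} [MeasurableSpace α] {g : History K t → Fin K → α}
    (hg : ∀ i, Measurable fun h => g h i) {a : History K t → Fin K} (ha : Measurable a) :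
    Measurable fun h => g h (a h) := by
  intro s hs
  have : (fun h => g h (a h)) ⁻¹' s = ⋃ i, a ⁻¹' {i} ∩ (fun h => g h i) ⁻¹' s := by
    ext h
    simp
  rw [this]
  exact MeasurableSet.iUnion fun i => (ha (measurableSet_singleton i)).inter (hg i hs)

theorem measurableSet_commitTest {K T : ℕ} (tieL tieE : TieRule K) (t : ℕ)
    (o : Option (Fin K)) : MeasurableSet {h | commitTest T tieL tieE t h = o} := by
  have hL : Measurable (lcbArm T tieL t) := measurable_tie tieL _ measurable_lcb
  have hE : Measurable (ucbArm T tieE t) := measurable_tie tieE _ measurable_ucb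
  let _ : MeasurableSpace (Option (Fin K)) := ⊤
  have hsome : Measurable (some : Fin K → Option (Fin K)) := measurable_from_top
  have key : Measurable (commitTest T tieL tieE t) := by
    unfold commitTest
    refine Measurable.ite (MeasurableSet.const _) measurable_const ?_
    refine Measurable.ite ?_ (hsome.comp hL) ?_
    · rw [Set.ofPred_forall]
      refine MeasurableSet.iInter fun i => ?_
      have h1 : MeasurableSet {h | i = lcbArm T tieL t h} := by
        simpa [Set.preimage, eq_comm] using hL (measurableSet_singleton i)
      have h2 : MeasurableSet {h | ucb T h i < lcb T h (lcbArm T tieL t h)} :=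
        measurableSet_lt (measurable_ucb i) (measurable_eval measurable_lcb hL)
      have : {h : History K t | i ≠ lcbArm T tieL t h →
          ucb T h i < lcb T h (lcbArm T tieL t h)} =
          {h | i = lcbArm T tieL t h} ∪ {h | ucb T h i < lcb T h (lcbArm T tieL t h)} := by
        ext h
        simp only [Set.mem_ofPred_eq, Set.mem_union]
        tauto
      rw [this]
      exact h1.union h2
    · refine Measurable.ite ?_ (hsome.comp hE) measurable_const
      exact measurableSet_le measurable_const (measurable_eval measurable_count hE)
  exact key (MeasurableSpace.measurableSet_top (s := {o}))

theorem measurableSet_phase {K T : ℕ} (tieL tieE : TieRule K) (t : ℕ) (o : Option (Fin K)) :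
    MeasurableSet {h | phase T tieL tieE t h = o} := by
  induction t generalizing o with
  | zero => exact MeasurableSet.const (none = o)
  | succ t ih =>
    have hr : Measurable fun (h : History K (t + 1)) (s : Fin t) => h s.castSucc :=
      measurable_pi_iff.2 fun s => measurable_pi_apply _
    have : {h | phase T tieL tieE (t + 1) h = o} =
        ⋃ p : Option (Fin K), ⋃ q : Option (Fin K), ⋃ _ : p.or q = o,
          ((fun (h : History K (t + 1)) (s : Fin t) => h s.castSucc) ⁻¹'
            {h | phase T tieL tieE t h = p}) ∩ {h | commitTest T tieL tieE (t + 1) h = q} := by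
      ext h
      simp [phase]
    rw [this]
    exact MeasurableSet.iUnion fun p => MeasurableSet.iUnion fun q => MeasurableSet.iUnion fun _ =>
      (hr (ih p)).inter (measurableSet_commitTest tieL tieE (t + 1) q)

theorem measurable_adaArm {K T : ℕ} (tieL tieE : TieRule K) (t : ℕ) :
    Measurable (adaArm T tieL tieE t) := by
  have hE : Measurable (ucbArm T tieE t) := measurable_tie tieE _ measurable_ucb
  let _ : MeasurableSpace (Option (Fin K)) := ⊤
  intro s hs
  have : adaArm T tieL tieE t ⁻¹' s =
      ⋃ p : Option (Fin K), {h | phase T tieL tieE t h = p} ∩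
        (fun h => p.getD (if ht : t < K then ⟨t, ht⟩ else ucbArm T tieE t h)) ⁻¹' s := by
    ext h
    simp only [adaArm, Set.mem_preimage, Set.mem_iUnion, Set.mem_inter_iff, Set.mem_ofPred_eq,
      exists_eq_left']
    cases phase T tieL tieE t h <;> simp
  rw [this]
  refine MeasurableSet.iUnion fun p => (measurableSet_phase tieL tieE t p).inter ?_
  have : Measurable fun h : History K t =>
      p.getD (if ht : t < K then ⟨t, ht⟩ else ucbArm T tieE t h) := by
    cases p with
    | some i => exact measurable_const
    | none =>
      by_cases ht : t < K
      · simp only [ht, dite_true]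
        exact measurable_const
      · simpa [ht] using hE
  exact this hs

/-- The policy ADA-ETC for `K` arms and horizon `T`, with the given rules for breaking ties in the
choice of `L` and of `E`. -/
noncomputable def adaETC (K T : ℕ) (tieL tieE : TieRule K) : Policy K where
  arm := adaArm T tieL tieE
  measurable_arm := measurable_adaArm tieL tieE

/-- `log⁺ a = log (max a 1)`. -/
noncomputable def logPlus (a : ℝ) : ℝ := Real.log (max a 1)

/-- The instance-dependent bound for `K = k + 1` arms with means `μ 0 > μ 1 ≥ … ≥ μ k` and gaps
`Δ i = μ 0 - μ i`. The sums run over the suboptimal arms `i.succ`, `i : Fin k`, and the arm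
preceding `i.succ` is `i.castSucc`. -/
noncomputable def instanceBound (k T : ℕ) (μ : Fin (k + 1) → ℝ) : ℝ :=
  let K : ℝ := ((k + 1 : ℕ) : ℝ)
  let τ : ℝ := (tau (k + 1) T : ℝ)
  let Δ : Fin (k + 1) → ℝ := fun i => μ 0 - μ i
  μ 0 * ∑ i : Fin k,
      min (10 / Δ i.succ ^ 2 + 16 / Δ i.succ ^ 2 * logPlus (T * Δ i.succ ^ 3 / K)
        + 24 / Δ i.succ ^ 2 * Real.sqrt (logPlus (T * Δ i.succ ^ 3 / K))) τ
    + μ 0 * τ * ∑ i : Fin k, min 2 (648 * K / (T * Δ i.succ ^ 3))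
    + ∑ i : Fin k, Real.exp (-(τ * Δ i.succ ^ 2 / 2)) * T * Δ i.succ
    + ∑ i : Fin k, min 1 (320 * K / (T * Δ i.succ ^ 3)) * T * (Δ i.succ - Δ i.castSucc)

end Bandit

namespace Bandit

/-! ### The reward table -/

/-! Regret decomposition. Rewards are nonnegative, so the largest total is at most the sum of all
totals. By Wald's identity no policy therefore beats `mean ν b * T`, with `b` a best arm. For a
lower bound on what ADA-ETC earns, suppose it commits to `i ≠ b`. At that moment `i` has exactly `τ`
pulls and the largest UCB, which at `τ` pulls is its empirical mean, while `b` has at most `τ`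
pulls. Hence `i` has already collected at least as much as `b`, and everything earned from `i`
afterwards comes on top of the total of `b` (`total_add_commitReward_le`). Taking expectations, each
exploratory pull of an arm `i ≠ b` costs at most `μ_b`, and each committed round costs the gap `Δ_i`
(`regret_adaETC_le`).

Reduction to the table. Exploring `i` after `n ≥ 1` pulls, or committing to it with `n = τ`, forces
`UCB_b(m) ≤ UCB_i(n)` for some `1 ≤ m ≤ τ` (`lt_exploreCount`, `commit_invariant`). So either the
UCB of `b` falls below its mean by `Δ_i / 2`, or that of `i` exceeds its own mean by `Δ_i / 2`.
Dyadic peeling with a maximal Hoeffding inequality bounds the probability of an underestimate by `x`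
by `36 (K/T) / x³` (`measureReal_underestimated_le`). The overestimates are summed over `n` in
`sum_measureReal_ucbTable_ge_le`; at `n = τ` plain Hoeffding suffices.

Part (i). An underestimate of `b` costs at most `τ` pulls of each arm during exploration. For the
commitment, the underestimation events are nested in the gap, and summation by parts over the sorted
gaps produces the increments `Δ_i - Δ_{i-1}` (`sum_gap_mul_commitCount_le`).

Part (ii). Exploration costs at most `K τ`, of order `K^{1/3} T^{2/3}`. The gap of the committed arm
is at most the underestimate of `b` plus the error of the empirical mean of that arm. With `ρ =
(K/T)^{1/3}`, integrating the cubic tail makes the former of order `ρ`. The latter is at most a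
maximum of `K` subgaussian errors at scale `1/√τ ≤ ρ`, hence of order `ρ √(log K)`
(`integral_gap_mul_commitCount_le`). -/

instance isProbabilityMeasure_tableLaw {K : ℕ} (ν : Fin K → ProbabilityMeasure ℝ) :
    IsProbabilityMeasure (tableLaw ν) := by
  unfold tableLaw
  infer_instance

theorem map_eval_tableLaw {K : ℕ} (ν : Fin K → ProbabilityMeasure ℝ) (p : Fin K × ℕ) :
    (tableLaw ν).map (fun u => u p) = (ν p.1 : Measure ℝ) :=
  Measure.infinitePi_map_eval (fun p : Fin K × ℕ => (ν p.1 : Measure ℝ)) p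

theorem ae_mem_Icc {K : ℕ} {ν : Fin K → ProbabilityMeasure ℝ} (hν : ν ∈ instances K) :
    ∀ᵐ u ∂tableLaw ν, ∀ p, u p ∈ Set.Icc (0 : ℝ) 1 := by
  rw [ae_all_iff]
  intro p
  have h := hν p.1
  rw [← map_eval_tableLaw ν p] at h
  exact ae_of_ae_map (measurable_pi_apply p).aemeasurable h

theorem integral_eval_tableLaw {K : ℕ} (ν : Fin K → ProbabilityMeasure ℝ) (p : Fin K × ℕ)
    {φ : ℝ → ℝ} (hφ : Measurable φ) :
    ∫ u, φ (u p) ∂tableLaw ν = ∫ x, φ x ∂(ν p.1 : Measure ℝ) := by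
  rw [← map_eval_tableLaw ν p, integral_map (measurable_pi_apply p).aemeasurable
    hφ.aestronglyMeasurable]

/-- A function of the table that ignores the entry `p` is independent of that entry. -/
theorem indepFun_of_update_eq {K : ℕ} (ν : Fin K → ProbabilityMeasure ℝ) (p : Fin K × ℕ)
    {H : (Fin K × ℕ → ℝ) → ℝ} (hH : Measurable H)
    (h : ∀ u, H (Function.update u p 0) = H u) :
    ProbabilityTheory.IndepFun H (fun u => u p) (tableLaw ν) := by
  have hi : ProbabilityTheory.iIndepFun (fun (q : Fin K × ℕ) (u : Fin K × ℕ → ℝ) => u q)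
      (tableLaw ν) :=
    ProbabilityTheory.iIndepFun_infinitePi (P := fun q : Fin K × ℕ => (ν q.1 : Measure ℝ))
      (X := fun _ x => x) (by fun_prop)
  have hd := ProbabilityTheory.indep_iSup_of_disjoint (S := {p}ᶜ) (T := {p})
    (fun q => (measurable_pi_apply q).comap_le) hi.iIndep disjoint_compl_left
  rw [ProbabilityTheory.IndepFun_iff_Indep]
  refine ProbabilityTheory.indep_of_indep_of_le_left
    (ProbabilityTheory.indep_of_indep_of_le_right hd ?_) ?_
  · exact le_iSup₂_of_le p rfl le_rfl
  -- Overwriting the entry `p` by `0` makes `H` factor through the other coordinates, so its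
  -- σ-algebra lies below the one they generate.
  · have hc : H = H ∘ fun u => Function.update u p 0 := by
      funext u
      exact (h u).symm
    rw [hc, ← MeasurableSpace.comap_comp]
    refine (MeasurableSpace.comap_mono hH.comap_le).trans ?_
    rw [MeasurableSpace.pi, MeasurableSpace.comap_iSup]
    refine iSup_le fun q => ?_
    rw [MeasurableSpace.comap_comp]
    by_cases hq : q = p
    · subst hq
      have : ((fun v : Fin K × ℕ → ℝ => v q) ∘ fun u => Function.update u q 0) =
          fun _ => (0 : ℝ) := by
        funext u
        simp
      rw [this, MeasurableSpace.comap_const]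
      exact bot_le
    · have : ((fun v : Fin K × ℕ → ℝ => v q) ∘ fun u => Function.update u p 0) =
          fun u => u q := by
        funext u
        simp [hq]
      rw [this]
      exact le_iSup₂_of_le q hq le_rfl

theorem integral_mul_fresh {K : ℕ} (ν : Fin K → ProbabilityMeasure ℝ) (p : Fin K × ℕ)
    {H : (Fin K × ℕ → ℝ) → ℝ} (hH : Measurable H)
    (h : ∀ u, H (Function.update u p 0) = H u) {φ : ℝ → ℝ} (hφ : Measurable φ) :
    ∫ u, H u * φ (u p) ∂tableLaw ν =
      (∫ u, H u ∂tableLaw ν) * ∫ x, φ x ∂(ν p.1 : Measure ℝ) := by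
  have hi := (indepFun_of_update_eq ν p hH h).comp measurable_id hφ
  have := hi.integral_fun_mul_eq_mul_integral hH.aestronglyMeasurable
    (hφ.comp (measurable_pi_apply p)).aestronglyMeasurable
  rw [← integral_eval_tableLaw ν p hφ]
  exact this

/-! ### Runs of a policy -/

/-- The reward received in round `t + 1`. -/
noncomputable def reward {K : ℕ} (π : Policy K) (u : Fin K × ℕ → ℝ) (t : ℕ) : ℝ :=
  u (π.arm t (run π u t), count (run π u t) (π.arm t (run π u t)))

theorem run_succ_castSucc {K : ℕ} (π : Policy K) (u : Fin K × ℕ → ℝ) (t : ℕ) (s : Fin t) :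
    run π u (t + 1) s.castSucc = run π u t s := by
  simp [run]

theorem run_succ_last {K : ℕ} (π : Policy K) (u : Fin K × ℕ → ℝ) (t : ℕ) :
    run π u (t + 1) (Fin.last t) = (π.arm t (run π u t), reward π u t) := by
  simp [run, reward]

theorem count_eq_sum {K t : ℕ} (h : History K t) (i : Fin K) :
    count h i = ∑ s, if (h s).1 = i then 1 else 0 :=
  Finset.card_filter _ _

theorem count_run_zero {K : ℕ} (π : Policy K) (u : Fin K × ℕ → ℝ) (i : Fin K) :
    count (run π u 0) i = 0 := by
  simp [count_eq_sum]

theorem count_run_succ {K : ℕ} (π : Policy K) (u : Fin K × ℕ → ℝ) (t : ℕ) (i : Fin K) :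
    count (run π u (t + 1)) i =
      count (run π u t) i + if π.arm t (run π u t) = i then 1 else 0 := by
  simp only [count_eq_sum, Fin.sum_univ_castSucc, run_succ_castSucc, run_succ_last]

theorem total_run_zero {K : ℕ} (π : Policy K) (u : Fin K × ℕ → ℝ) (i : Fin K) :
    total (run π u 0) i = 0 := by
  simp [total]

theorem total_run_succ {K : ℕ} (π : Policy K) (u : Fin K × ℕ → ℝ) (t : ℕ) (i : Fin K) :
    total (run π u (t + 1)) i =
      total (run π u t) i + if π.arm t (run π u t) = i then reward π u t else 0 := by
  simp only [total, Fin.sum_univ_castSucc, run_succ_castSucc, run_succ_last]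

theorem count_run_mono {K : ℕ} (π : Policy K) (u : Fin K × ℕ → ℝ) (i : Fin K) :
    Monotone fun t => count (run π u t) i :=
  monotone_nat_of_le_succ fun t => by
    rw [count_run_succ]
    exact Nat.le_add_right _ _

theorem sum_count {K t : ℕ} (h : History K t) : ∑ i, count h i = t := by
  simp_rw [count_eq_sum]
  rw [Finset.sum_comm]
  simp

theorem count_le {K t : ℕ} (h : History K t) (i : Fin K) : count h i ≤ t := by
  calc count h i ≤ ∑ i, count h i :=
        Finset.single_le_sum (f := fun i => count h i) (fun _ _ => Nat.zero_le _)
          (Finset.mem_univ i)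
    _ = t := sum_count h

/-- The sum of the first `n` rewards of arm `i`. -/
noncomputable def partialSum {K : ℕ} (u : Fin K × ℕ → ℝ) (i : Fin K) (n : ℕ) : ℝ :=
  ∑ s ∈ Finset.range n, u (i, s)

theorem total_run {K : ℕ} (π : Policy K) (u : Fin K × ℕ → ℝ) (t : ℕ) (i : Fin K) :
    total (run π u t) i = partialSum u i (count (run π u t) i) := by
  induction t with
  | zero => simp [total_run_zero, count_run_zero, partialSum]
  | succ t ih =>
    rw [total_run_succ, count_run_succ, ih]
    by_cases h : π.arm t (run π u t) = i
    · simp [h, partialSum, Finset.sum_range_succ, reward]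
    · simp [h]

theorem total_run_eq_sum {K : ℕ} (π : Policy K) (u : Fin K × ℕ → ℝ) (t : ℕ) (i : Fin K) :
    total (run π u t) i =
      ∑ s ∈ Finset.range t, if π.arm s (run π u s) = i then reward π u s else 0 := by
  induction t with
  | zero => simp [total_run_zero]
  | succ t ih => rw [total_run_succ, ih, Finset.sum_range_succ]

theorem count_run_eq_sum {K : ℕ} (π : Policy K) (u : Fin K × ℕ → ℝ) (t : ℕ) (i : Fin K) :
    count (run π u t) i =
      ∑ s ∈ Finset.range t, if π.arm s (run π u s) = i then 1 else 0 := by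
  induction t with
  | zero => simp [count_run_zero]
  | succ t ih => rw [count_run_succ, ih, Finset.sum_range_succ]

/-- The entry `(i, n)` is read only by the pull that raises the count of `i` from `n` to `n + 1`;
until then the run cannot depend on it. -/
theorem run_update {K : ℕ} (π : Policy K) (u : Fin K × ℕ → ℝ) (i : Fin K) (n : ℕ) (x : ℝ)
    (t : ℕ) (h : count (run π u t) i ≤ n) :
    run π (Function.update u (i, n) x) t = run π u t := by
  induction t with
  | zero => rfl
  | succ t ih =>
    have hm : count (run π u t) i ≤ n := (count_run_mono π u i (Nat.le_succ t)).trans h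
    have e := ih hm
    have hne : ((π.arm t (run π u t), count (run π u t) (π.arm t (run π u t))) : Fin K × ℕ) ≠
        (i, n) := by
      intro hc
      obtain ⟨h1, h2⟩ := Prod.mk.inj hc
      rw [count_run_succ, if_pos h1] at h
      rw [h1] at h2
      omega
    simp only [run, e, Function.update_of_ne hne]

theorem measurable_run {K : ℕ} (π : Policy K) (t : ℕ) :
    Measurable fun u : Fin K × ℕ → ℝ => run π u t := by
  induction t with
  | zero => exact measurable_pi_iff.2 fun s => s.elim0
  | succ t ih =>
    have ha : Measurable fun u : Fin K × ℕ → ℝ => π.arm t (run π u t) :=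
      (π.measurable_arm t).comp ih
    refine measurable_pi_iff.2 fun s => ?_
    refine Fin.lastCases ?_ (fun s => ?_) s
    · simp only [run_succ_last]
      refine ha.prodMk ?_
      intro S hS
      have : (fun u => reward π u t) ⁻¹' S = ⋃ i, ⋃ n,
          {u | π.arm t (run π u t) = i} ∩ ({u | count (run π u t) i = n} ∩
            (fun u => u (i, n)) ⁻¹' S) := by
        ext u
        simp [reward]
      rw [this]
      refine MeasurableSet.iUnion fun i => MeasurableSet.iUnion fun n => ?_
      exact (ha (measurableSet_singleton i)).inter
        ((((measurable_count i).comp ih) (measurableSet_singleton n)).inter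
          (measurable_pi_apply _ hS))
    · simp only [run_succ_castSucc]
      exact (measurable_pi_apply s).comp ih

theorem measurable_reward {K : ℕ} (π : Policy K) (t : ℕ) :
    Measurable fun u : Fin K × ℕ → ℝ => reward π u t := by
  have := measurable_snd.comp ((measurable_pi_apply (Fin.last t)).comp (measurable_run π (t + 1)))
  simpa [Function.comp_def, run_succ_last] using this

theorem measurable_partialSum {K : ℕ} (i : Fin K) (n : ℕ) :
    Measurable fun u : Fin K × ℕ → ℝ => partialSum u i n :=
  Finset.measurable_sum _ fun _ _ => measurable_pi_apply _

theorem integrable_of_bounded {K : ℕ} {ν : Fin K → ProbabilityMeasure ℝ} (hν : ν ∈ instances K)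
    {f : (Fin K × ℕ → ℝ) → ℝ} (hf : Measurable f) (C : ℝ)
    (h : ∀ u, (∀ p, u p ∈ Set.Icc (0 : ℝ) 1) → |f u| ≤ C) : Integrable f (tableLaw ν) := by
  refine Integrable.of_bound hf.aestronglyMeasurable C ?_
  filter_upwards [ae_mem_Icc hν] with u hu using h u hu

theorem reward_mem_Icc {K : ℕ} (π : Policy K) {u : Fin K × ℕ → ℝ}
    (hu : ∀ p, u p ∈ Set.Icc (0 : ℝ) 1) (t : ℕ) : reward π u t ∈ Set.Icc (0 : ℝ) 1 :=
  hu _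

/-- The reward of the next round is a fresh sample of the arm that is played. -/
theorem integral_mul_reward {K : ℕ} {ν : Fin K → ProbabilityMeasure ℝ} (hν : ν ∈ instances K)
    (π : Policy K) (t : ℕ) (i : Fin K) {g : History K t → ℝ} (hg : Measurable g) {C : ℝ}
    (hC : ∀ h, |g h| ≤ C) :
    ∫ u, (if π.arm t (run π u t) = i then g (run π u t) * reward π u t else 0) ∂tableLaw ν =
      mean ν i * ∫ u, (if π.arm t (run π u t) = i then g (run π u t) else 0) ∂tableLaw ν := by
  have hr := measurable_run π t
  have ha : Measurable fun u : Fin K × ℕ → ℝ => π.arm t (run π u t) :=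
    (π.measurable_arm t).comp hr
  -- Splitting by the current count `n` of arm `i` turns the random table position of the next
  -- reward into the fixed entry `(i, n)`, which `H n` ignores.
  let H : ℕ → (Fin K × ℕ → ℝ) → ℝ := fun n u =>
    if π.arm t (run π u t) = i ∧ count (run π u t) i = n then g (run π u t) else 0
  have hset : ∀ n, MeasurableSet {u : Fin K × ℕ → ℝ |
      π.arm t (run π u t) = i ∧ count (run π u t) i = n} := fun n =>
    (ha (measurableSet_singleton i)).inter
      (((measurable_count i).comp hr) (measurableSet_singleton n))
  have hHm : ∀ n, Measurable (H n) := fun n =>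
    Measurable.ite (hset n) (hg.comp hr) measurable_const
  have hHb : ∀ n u, |H n u| ≤ C := by
    intro n u
    simp only [H]
    split_ifs
    · exact hC _
    · simpa using (abs_nonneg _).trans (hC (run π u t))
  have hHu : ∀ n u, H n (Function.update u (i, n) 0) = H n u := by
    intro n u
    simp only [H]
    by_cases h : count (run π u t) i ≤ n
    · rw [run_update π u i n 0 t h]
    -- If the modified table had count at most `n`, restoring the original entry would leave its run
    -- unchanged, contradicting `h`. So both sides vanish.
    · have h' : ¬ count (run π (Function.update u (i, n) 0) t) i ≤ n := by
        intro hc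
        have := run_update π (Function.update u (i, n) 0) i n (u (i, n)) t hc
        rw [Function.update_idem, Function.update_eq_self] at this
        rw [this] at h
        exact h hc
      rw [if_neg (by omega), if_neg (by omega)]
  have key : ∀ n, ∫ u, H n u * u (i, n) ∂tableLaw ν =
      mean ν i * ∫ u, H n u ∂tableLaw ν := by
    intro n
    have := integral_mul_fresh ν (i, n) (hHm n) (hHu n) measurable_id
    simp only [id_eq] at this
    rw [this, mul_comm]
    rfl
  have hI : ∀ n, Integrable (H n) (tableLaw ν) := fun n =>
    integrable_of_bounded hν (hHm n) C fun u _ => hHb n u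
  have hI' : ∀ n, Integrable (fun u => H n u * u (i, n)) (tableLaw ν) := fun n =>
    integrable_of_bounded hν ((hHm n).mul (measurable_pi_apply _)) C fun u hu => by
      rw [abs_mul]
      have h1 : |u (i, n)| ≤ 1 := abs_le.2 ⟨by linarith [(hu (i, n)).1], (hu (i, n)).2⟩
      calc |H n u| * |u (i, n)| ≤ |H n u| * 1 := by gcongr
        _ ≤ C := by simpa using hHb n u
  have e1 : ∀ u : Fin K × ℕ → ℝ,
      (if π.arm t (run π u t) = i then g (run π u t) * reward π u t else 0) =
        ∑ n ∈ Finset.range (t + 1), H n u * u (i, n) := by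
    intro u
    by_cases h : π.arm t (run π u t) = i
    · rw [if_pos h, Finset.sum_eq_single (count (run π u t) i)]
      · simp [H, h, reward]
      · intro n _ hn
        simp [H, Ne.symm hn]
      · intro hn
        exact absurd (Finset.mem_range.2 (Nat.lt_succ_of_le (count_le _ _))) hn
    · simp [H, h]
  have e2 : ∀ u : Fin K × ℕ → ℝ,
      (if π.arm t (run π u t) = i then g (run π u t) else 0) =
        ∑ n ∈ Finset.range (t + 1), H n u := by
    intro u
    by_cases h : π.arm t (run π u t) = i
    · rw [if_pos h, Finset.sum_eq_single (count (run π u t) i)]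
      · simp [H, h]
      · intro n _ hn
        simp [H, Ne.symm hn]
      · intro hn
        exact absurd (Finset.mem_range.2 (Nat.lt_succ_of_le (count_le _ _))) hn
    · simp [H, h]
  simp_rw [e1, e2]
  rw [integral_finsetSum _ fun n _ => hI' n, integral_finsetSum _ fun n _ => hI n,
    Finset.mul_sum]
  exact Finset.sum_congr rfl fun n _ => key n

/-! ### Wald's identity and the benchmark for the supremum over policies. -/

theorem mean_mem_Icc {K : ℕ} {ν : Fin K → ProbabilityMeasure ℝ} (hν : ν ∈ instances K)
    (i : Fin K) : mean ν i ∈ Set.Icc (0 : ℝ) 1 := by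
  have hi : Integrable (fun x : ℝ => x) (ν i : Measure ℝ) :=
    Integrable.of_mem_Icc 0 1 measurable_id.aemeasurable (hν i)
  constructor
  · refine integral_nonneg_of_ae ?_
    filter_upwards [hν i] with x hx using hx.1
  · calc mean ν i ≤ ∫ _, (1 : ℝ) ∂(ν i : Measure ℝ) := by
          refine integral_mono_ae hi (integrable_const _) ?_
          filter_upwards [hν i] with x hx using hx.2
      _ = 1 := by simp

/-- Wald's identity for the cumulative reward of an arm. -/
theorem integral_total {K : ℕ} {ν : Fin K → ProbabilityMeasure ℝ} (hν : ν ∈ instances K)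
    (π : Policy K) (t : ℕ) (i : Fin K) :
    ∫ u, total (run π u t) i ∂tableLaw ν =
      mean ν i * ∫ u, (count (run π u t) i : ℝ) ∂tableLaw ν := by
  have hs : ∀ s, MeasurableSet {u : Fin K × ℕ → ℝ | π.arm s (run π u s) = i} := fun s =>
    ((π.measurable_arm s).comp (measurable_run π s)) (measurableSet_singleton i)
  simp_rw [total_run_eq_sum, count_run_eq_sum]
  push_cast
  rw [integral_finsetSum, integral_finsetSum, Finset.mul_sum]
  · refine Finset.sum_congr rfl fun s _ => ?_
    simpa using integral_mul_reward hν π s i (g := fun _ => 1) measurable_const (C := 1) (by simp)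
  · intro s _
    refine integrable_of_bounded hν (Measurable.ite (hs s) measurable_const measurable_const) 1 ?_
    intro u _
    split_ifs <;> simp
  · intro s _
    refine integrable_of_bounded hν
      (Measurable.ite (hs s) (measurable_reward π s) measurable_const) 1 ?_
    intro u hu
    have := reward_mem_Icc π hu s
    split_ifs
    · exact abs_le.2 ⟨by linarith [this.1], this.2⟩
    · simp

theorem total_nonneg {K : ℕ} (π : Policy K) {u : Fin K × ℕ → ℝ}
    (hu : ∀ p, u p ∈ Set.Icc (0 : ℝ) 1) (t : ℕ) (i : Fin K) : 0 ≤ total (run π u t) i := by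
  rw [total_run]
  exact Finset.sum_nonneg fun s _ => (hu _).1

theorem total_le {K : ℕ} (π : Policy K) {u : Fin K × ℕ → ℝ}
    (hu : ∀ p, u p ∈ Set.Icc (0 : ℝ) 1) (t : ℕ) (i : Fin K) : total (run π u t) i ≤ t := by
  rw [total_run]
  calc partialSum u i (count (run π u t) i) ≤ ∑ s ∈ Finset.range (count (run π u t) i), (1 : ℝ) :=
        Finset.sum_le_sum fun s _ => (hu _).2
    _ = count (run π u t) i := by simp
    _ ≤ t := by exact_mod_cast count_le _ _

theorem measurable_total_run {K : ℕ} (π : Policy K) (t : ℕ) (i : Fin K) :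
    Measurable fun u : Fin K × ℕ → ℝ => total (run π u t) i :=
  (measurable_total i).comp (measurable_run π t)

theorem measurable_count_run {K : ℕ} (π : Policy K) (t : ℕ) (i : Fin K) :
    Measurable fun u : Fin K × ℕ → ℝ => (count (run π u t) i : ℝ) :=
  measurable_from_top.comp ((measurable_count i).comp (measurable_run π t))

theorem integrable_total {K : ℕ} {ν : Fin K → ProbabilityMeasure ℝ} (hν : ν ∈ instances K)
    (π : Policy K) (t : ℕ) (i : Fin K) :
    Integrable (fun u => total (run π u t) i) (tableLaw ν) :=
  integrable_of_bounded hν (measurable_total_run π t i) t fun u hu =>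
    abs_le.2 ⟨by linarith [total_nonneg π hu t i, Nat.cast_nonneg (α := ℝ) t], total_le π hu t i⟩

theorem integrable_count {K : ℕ} {ν : Fin K → ProbabilityMeasure ℝ} (hν : ν ∈ instances K)
    (π : Policy K) (t : ℕ) (i : Fin K) :
    Integrable (fun u => (count (run π u t) i : ℝ)) (tableLaw ν) :=
  integrable_of_bounded hν (measurable_count_run π t i) t fun u _ => by
    rw [abs_of_nonneg (Nat.cast_nonneg _)]
    exact_mod_cast count_le _ _

theorem integrable_iSup_total {K : ℕ} {ν : Fin K → ProbabilityMeasure ℝ} (hν : ν ∈ instances K)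
    (π : Policy K) (t : ℕ) :
    Integrable (fun u => ⨆ i : Fin K, total (run π u t) i) (tableLaw ν) := by
  refine integrable_of_bounded hν (Measurable.iSup fun i => measurable_total_run π t i) t ?_
  intro u hu
  have h0 : 0 ≤ ⨆ i : Fin K, total (run π u t) i :=
    Real.iSup_nonneg fun i => total_nonneg π hu t i
  rw [abs_of_nonneg h0]
  exact Real.iSup_le (fun i => total_le π hu t i) (Nat.cast_nonneg t)

/-- No policy collects more than the best mean in every round. -/
theorem maxReward_le {K : ℕ} {ν : Fin K → ProbabilityMeasure ℝ} (hν : ν ∈ instances K)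
    {b : Fin K} (hb : ∀ i, mean ν i ≤ mean ν b) (T : ℕ) (π : Policy K) :
    maxReward T π ν ≤ mean ν b * T := by
  have hc : ∀ u : Fin K × ℕ → ℝ, ∑ i, (count (run π u T) i : ℝ) = T := fun u => by
    exact_mod_cast sum_count (run π u T)
  calc maxReward T π ν ≤ ∫ u, ∑ i, total (run π u T) i ∂tableLaw ν := by
        refine integral_mono_ae (integrable_iSup_total hν π T)
          (integrable_finsetSum _ fun i _ => integrable_total hν π T i) ?_
        filter_upwards [ae_mem_Icc hν] with u hu
        refine Real.iSup_le (fun i => ?_) (Finset.sum_nonneg fun i _ => total_nonneg π hu T i)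
        exact Finset.single_le_sum (f := fun i => total (run π u T) i)
          (fun i _ => total_nonneg π hu T i) (Finset.mem_univ i)
    _ = ∑ i, mean ν i * ∫ u, (count (run π u T) i : ℝ) ∂tableLaw ν := by
        rw [integral_finsetSum _ fun i _ => integrable_total hν π T i]
        exact Finset.sum_congr rfl fun i _ => integral_total hν π T i
    _ ≤ ∑ i, mean ν b * ∫ u, (count (run π u T) i : ℝ) ∂tableLaw ν := by
        refine Finset.sum_le_sum fun i _ => ?_
        exact mul_le_mul_of_nonneg_right (hb i) (integral_nonneg fun u => Nat.cast_nonneg _)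
    _ = mean ν b * T := by
        rw [← Finset.mul_sum, ← integral_finsetSum _ fun i _ => integrable_count hν π T i]
        simp [hc]

theorem regret_le_sub {K : ℕ} {ν : Fin K → ProbabilityMeasure ℝ} (hν : ν ∈ instances K)
    {b : Fin K} (hb : ∀ i, mean ν i ≤ mean ν b) (T : ℕ) (π : Policy K) :
    regret T π ν ≤ mean ν b * T - maxReward T π ν := by
  have : Nonempty (Policy K) := ⟨π⟩
  exact sub_le_sub_right (ciSup_le fun π' => maxReward_le hν hb T π') _

/-! ### The confidence bounds as functions of the reward table -/

/-- The width of the upper confidence interval after `n` pulls. -/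
noncomputable def bonus (K T n : ℕ) : ℝ :=
  Real.sqrt (4 / (n : ℝ) * logPlus ((T : ℝ) / ((K : ℝ) * (n : ℝ) ^ (3 / 2 : ℝ))))

/-- The upper confidence bound of arm `i` after `n ≥ 1` pulls. -/
noncomputable def ucbTable {K : ℕ} (T : ℕ) (u : Fin K × ℕ → ℝ) (i : Fin K) (n : ℕ) : ℝ :=
  partialSum u i n / n + bonus K T n

theorem logPlus_nonneg (a : ℝ) : 0 ≤ logPlus a :=
  Real.log_nonneg (le_max_right _ _)

theorem logPlus_of_one_le {a : ℝ} (h : 1 ≤ a) : logPlus a = Real.log a := by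
  rw [logPlus, max_eq_left h]

theorem logPlus_of_le_one {a : ℝ} (h : a ≤ 1) : logPlus a = 0 := by
  rw [logPlus, max_eq_right h, Real.log_one]

theorem logPlus_mono {a b : ℝ} (h : a ≤ b) : logPlus a ≤ logPlus b :=
  Real.log_le_log (by positivity) (max_le_max_right 1 h)

/-- The threshold `τ` is exactly where `T / (K n^{3/2})` stops exceeding `1`. The indicator in the
UCB thus does the same as replacing `log` by `log⁺`. -/
theorem lt_tau_iff {K : ℕ} (hK : 0 < K) (T n : ℕ) :
    n < tau K T ↔ (n : ℝ) ^ (3 / 2 : ℝ) < T / K := by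
  have hx : (0 : ℝ) ≤ (T : ℝ) / K := by positivity
  rw [tau, Nat.lt_ceil, ← Real.div_rpow (Nat.cast_nonneg _) (Nat.cast_nonneg _)]
  rw [← Real.rpow_lt_rpow_iff (z := (3 / 2 : ℝ)) (Nat.cast_nonneg _) (by positivity) (by norm_num),
    ← Real.rpow_mul hx]
  norm_num

theorem tau_pos {K T : ℕ} (hK : 0 < K) (hT : 0 < T) : 0 < tau K T := by
  rw [lt_tau_iff hK]
  have : (0 : ℝ) < (T : ℝ) / K := by positivity
  simpa using this

theorem bonus_nonneg (K T n : ℕ) : 0 ≤ bonus K T n := Real.sqrt_nonneg _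

theorem bonus_tau {K : ℕ} (hK : 0 < K) (T : ℕ) : bonus K T (tau K T) = 0 := by
  have h := (lt_tau_iff hK T (tau K T)).not.1 (lt_irrefl _)
  push Not at h
  have hK' : (0 : ℝ) < K := by exact_mod_cast hK
  rw [bonus, logPlus_of_le_one, mul_zero, Real.sqrt_zero]
  refine div_le_one_of_le₀ ?_ (by positivity)
  rwa [div_le_iff₀' hK'] at h

/-- Passes from histories to the reward table: a UCB seen along a run is a fixed function of the
table and the pull count, so bounds over all counts apply to every run. -/
theorem ucb_run {K T : ℕ} (hK : 0 < K) (π : Policy K) (u : Fin K × ℕ → ℝ) {t : ℕ} {i : Fin K}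
    (h : 1 ≤ count (run π u t) i) (h' : count (run π u t) i ≤ tau K T) :
    ucb T (run π u t) i = ucbTable T u i (count (run π u t) i) := by
  have hK' : (0 : ℝ) < K := by exact_mod_cast hK
  rw [ucb, ucbTable, empMean, total_run]
  congr 1
  split_ifs with hn
  · rw [bonus, logPlus_of_one_le]
    have hpos : (0 : ℝ) < (count (run π u t) i : ℝ) := by exact_mod_cast h
    rw [lt_tau_iff hK, lt_div_iff₀' hK'] at hn
    rw [one_le_div (by positivity)]
    exact hn.le
  · rw [le_antisymm h' (not_lt.1 hn), bonus_tau hK]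

/-! ### Sample paths of ADA-ETC -/

section Paths

theorem argmax_nonempty {K : ℕ} (hK : 0 < K) (f : Fin K → ℝ) : (argmax f).Nonempty := by
  have : Nonempty (Fin K) := ⟨⟨0, hK⟩⟩
  obtain ⟨i, hi⟩ := Finite.exists_max f
  exact ⟨i, by simpa [argmax] using hi⟩

theorem ucb_le_ucbArm {K : ℕ} (hK : 0 < K) (T : ℕ) (tie : TieRule K) {t : ℕ} (h : History K t)
    (j : Fin K) : ucb T h j ≤ ucb T h (ucbArm T tie t h) := by
  have := tie.choose_mem t h _ (argmax_nonempty hK (ucb T h))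
  simp only [argmax, Finset.mem_filter] at this
  exact this.2 j

theorem empMean_nonneg {K t : ℕ} {h : History K t} (h0 : ∀ i, 0 ≤ total h i) (i : Fin K) :
    0 ≤ empMean h i := div_nonneg (h0 i) (Nat.cast_nonneg _)

theorem empMean_le_ucb {K T t : ℕ} (h : History K t) (i : Fin K) : empMean h i ≤ ucb T h i := by
  rw [ucb]
  split_ifs
  · linarith [Real.sqrt_nonneg (4 / (count h i : ℝ) *
      Real.log ((T : ℝ) / ((K : ℝ) * (count h i : ℝ) ^ (3 / 2 : ℝ))))]
  · simp

/-- Both ways of committing lead to the same conclusion: an arm with at least `τ` pulls and maximal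
UCB. -/
theorem commitTest_eq_some {K T : ℕ} (hK : 2 ≤ K) {tieL tieE : TieRule K} {t : ℕ}
    {h : History K t} (h0 : ∀ i, 0 ≤ total h i) {i : Fin K}
    (hc : commitTest T tieL tieE t h = some i) :
    K ≤ t ∧ tau K T ≤ count h i ∧ ∀ j, ucb T h j ≤ ucb T h i := by
  unfold commitTest at hc
  split_ifs at hc with h1 h2 h3
  · obtain rfl := Option.some.inj hc
    set L := lcbArm T tieL t h
    -- A second arm is needed: its UCB is nonnegative, so the LCB of `L` is positive, whereas an LCB
    -- is zero before `τ` pulls.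
    have : Nontrivial (Fin K) := Fin.nontrivial_iff_two_le.2 hK
    obtain ⟨j, hj⟩ := exists_ne L
    have hpos : 0 < lcb T h L :=
      ((empMean_nonneg h0 j).trans (empMean_le_ucb h j)).trans_lt (h2 j hj)
    have hτ : ¬ count h L < tau K T := by
      intro hlt
      rw [lcb, if_pos hlt, sub_self] at hpos
      exact lt_irrefl _ hpos
    refine ⟨not_lt.1 h1, not_lt.1 hτ, fun j => ?_⟩
    by_cases hj : j = L
    · rw [hj]
    · have := h2 j hj
      rw [lcb, if_neg hτ, sub_zero] at this
      exact this.le.trans (empMean_le_ucb h L)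
  · obtain rfl := Option.some.inj hc
    exact ⟨not_lt.1 h1, h3, ucb_le_ucbArm (by omega) T tieE h⟩

theorem count_ucbArm_lt {K T : ℕ} {tieL tieE : TieRule K} {t : ℕ} (ht : K ≤ t)
    {h : History K t} (hc : commitTest T tieL tieE t h = none) :
    count h (ucbArm T tieE t h) < tau K T := by
  unfold commitTest at hc
  split_ifs at hc with h1 h2 h3
  · omega
  · exact not_le.1 h3

/-! ### Phases, pull counts and rewards along a run of ADA-ETC. -/

variable {K T : ℕ} {tieL tieE : TieRule K} {u : Fin K × ℕ → ℝ}

/-- The phase of ADA-ETC in round `t + 1` on the reward table `u`. -/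
noncomputable def phaseAt (T : ℕ) (tieL tieE : TieRule K) (u : Fin K × ℕ → ℝ) (t : ℕ) :
    Option (Fin K) :=
  phase T tieL tieE t (run (adaETC K T tieL tieE) u t)

theorem phaseAt_succ (t : ℕ) :
    phaseAt T tieL tieE u (t + 1) = (phaseAt T tieL tieE u t).or
      (commitTest T tieL tieE (t + 1) (run (adaETC K T tieL tieE) u (t + 1))) := by
  simp only [phaseAt, phase, run_succ_castSucc]

theorem arm_eq_of_phaseAt {t : ℕ} {i : Fin K} (h : phaseAt T tieL tieE u t = some i) :
    (adaETC K T tieL tieE).arm t (run (adaETC K T tieL tieE) u t) = i := by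
  have h' : phase T tieL tieE t (run (adaETC K T tieL tieE) u t) = some i := h
  simp only [adaETC, adaArm] at h' ⊢
  rw [h']

theorem arm_eq_of_lt {t : ℕ} (h : phaseAt T tieL tieE u t = none) (ht : t < K) :
    (adaETC K T tieL tieE).arm t (run (adaETC K T tieL tieE) u t) = ⟨t, ht⟩ := by
  have h' : phase T tieL tieE t (run (adaETC K T tieL tieE) u t) = none := h
  simp only [adaETC, adaArm] at h' ⊢
  rw [h']
  simp [ht]

theorem arm_eq_of_ge {t : ℕ} (h : phaseAt T tieL tieE u t = none) (ht : K ≤ t) :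
    (adaETC K T tieL tieE).arm t (run (adaETC K T tieL tieE) u t) =
      ucbArm T tieE t (run (adaETC K T tieL tieE) u t) := by
  have h' : phase T tieL tieE t (run (adaETC K T tieL tieE) u t) = none := h
  simp only [adaETC, adaArm] at h' ⊢
  rw [h']
  simp [not_lt.2 ht]

theorem commitTest_eq_none {t : ℕ} (hK : 0 < K) (h : phaseAt T tieL tieE u t = none)
    (ht : K ≤ t) :
    commitTest T tieL tieE t (run (adaETC K T tieL tieE) u t) = none := by
  obtain ⟨s, rfl⟩ : ∃ s, t = s + 1 := ⟨t - 1, by omega⟩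
  rw [phaseAt_succ, Option.or_eq_none_iff] at h
  exact h.2

/-- The number of pulls of each arm as long as the policy explores. -/
theorem count_explore_succ (hK : 0 < K) (hT : 0 < T) {t : ℕ}
    (h : phaseAt T tieL tieE u t = none)
    (hc : ∀ i, count (run (adaETC K T tieL tieE) u t) i ≤ tau K T ∧
      (t ≤ K → count (run (adaETC K T tieL tieE) u t) i = if i.val < t then 1 else 0) ∧
      (K ≤ t → 1 ≤ count (run (adaETC K T tieL tieE) u t) i)) (i : Fin K) :
    count (run (adaETC K T tieL tieE) u (t + 1)) i ≤ tau K T ∧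
      (t + 1 ≤ K → count (run (adaETC K T tieL tieE) u (t + 1)) i =
        if i.val < t + 1 then 1 else 0) ∧
      (K ≤ t + 1 → 1 ≤ count (run (adaETC K T tieL tieE) u (t + 1)) i) := by
  have hτ := tau_pos hK hT
  have hi := i.isLt
  rw [count_run_succ]
  by_cases ht : t < K
  · have ha := arm_eq_of_lt h ht
    have h2 := (hc i).2.1 ht.le
    rw [ha, h2]
    by_cases hit : (⟨t, ht⟩ : Fin K) = i
    · subst hit
      simp
      omega
    · have : i.val ≠ t := fun e => hit (Fin.ext e.symm)
      rw [if_neg hit]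
      by_cases h3 : i.val < t
      · rw [if_pos h3, if_pos (by omega)]
        omega
      · rw [if_neg h3, if_neg (by omega)]
        omega
  · have htK := not_lt.1 ht
    have h3 := (hc i).2.2 htK
    refine ⟨?_, by omega, by omega⟩
    rw [arm_eq_of_ge h htK]
    split_ifs with he
    · have := count_ucbArm_lt htK (commitTest_eq_none hK h htK)
      rw [he] at this
      exact this
    · exact (hc i).1

theorem count_explore (hK : 0 < K) (hT : 0 < T) {t : ℕ} (h : phaseAt T tieL tieE u t = none)
    (i : Fin K) :
    count (run (adaETC K T tieL tieE) u t) i ≤ tau K T ∧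
      (t ≤ K → count (run (adaETC K T tieL tieE) u t) i = if i.val < t then 1 else 0) ∧
      (K ≤ t → 1 ≤ count (run (adaETC K T tieL tieE) u t) i) := by
  induction t generalizing i with
  | zero =>
    rw [count_run_zero]
    simp
    omega
  | succ t ih =>
    rw [phaseAt_succ, Option.or_eq_none_iff] at h
    exact count_explore_succ hK hT h.1 (ih h.1) i

/-- The state of the policy when it starts to commit. -/
theorem commit_start (hK : 2 ≤ K) (hT : 0 < T) (hu : ∀ p, u p ∈ Set.Icc (0 : ℝ) 1) {t : ℕ}
    {i : Fin K} (h : phaseAt T tieL tieE u t = none)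
    (h' : phaseAt T tieL tieE u (t + 1) = some i) (b : Fin K) :
    (∃ m, 1 ≤ m ∧ m ≤ tau K T ∧ ucbTable T u b m ≤ ucbTable T u i (tau K T)) ∧
      total (run (adaETC K T tieL tieE) u (t + 1)) b ≤
        total (run (adaETC K T tieL tieE) u (t + 1)) i := by
  have hK0 : 0 < K := by omega
  have hτ := tau_pos hK0 hT
  rw [phaseAt_succ, h, Option.none_or] at h'
  obtain ⟨htK, hci, hucb⟩ := commitTest_eq_some hK (total_nonneg _ hu _) h'
  have hc := count_explore_succ hK0 hT h (count_explore hK0 hT h)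
  have hcb := hc b
  have hci' : count (run (adaETC K T tieL tieE) u (t + 1)) i = tau K T :=
    le_antisymm (hc i).1 hci
  have hb := hucb b
  rw [ucb_run hK0 _ u (hcb.2.2 htK) hcb.1, ucb_run hK0 _ u ((hc i).2.2 htK) (hc i).1, hci'] at hb
  refine ⟨⟨_, hcb.2.2 htK, hcb.1, hb⟩, ?_⟩
  rw [total_run, total_run, hci']
  have h1 := hcb.2.2 htK
  have h2 := hcb.1
  set m := count (run (adaETC K T tieL tieE) u (t + 1)) b
  rw [ucbTable, ucbTable, bonus_tau hK0, add_zero] at hb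
  -- The bonus of `i` vanishes at `τ` pulls and that of `b` is nonnegative, so the UCB comparison
  -- orders the empirical means. With `m ≤ τ` and nonnegative rewards it then orders the totals.
  have h3 : partialSum u b m / m ≤ partialSum u i (tau K T) / (tau K T : ℝ) := by
    linarith [bonus_nonneg K T m]
  have hm : (0 : ℝ) < m := by exact_mod_cast h1
  have hτ' : (0 : ℝ) < tau K T := by exact_mod_cast hτ
  have hmτ : (m : ℝ) ≤ tau K T := by exact_mod_cast h2
  have hS : 0 ≤ partialSum u i (tau K T) := Finset.sum_nonneg fun s _ => (hu _).1
  calc partialSum u b m = partialSum u b m / m * m := by field_simp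
    _ ≤ partialSum u i (tau K T) / (tau K T : ℝ) * (tau K T : ℝ) := by gcongr
    _ = partialSum u i (tau K T) := by field_simp

/-- The number of exploratory pulls of arm `i` in the first `t` rounds. -/
noncomputable def exploreCount (T : ℕ) (tieL tieE : TieRule K) (u : Fin K × ℕ → ℝ) (i : Fin K)
    (t : ℕ) : ℕ :=
  ∑ s ∈ Finset.range t, if phaseAt T tieL tieE u s = none ∧
    (adaETC K T tieL tieE).arm s (run (adaETC K T tieL tieE) u s) = i then 1 else 0

/-- The number of rounds among the first `t` in which the policy is committed to arm `i`. -/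
noncomputable def commitCount (T : ℕ) (tieL tieE : TieRule K) (u : Fin K × ℕ → ℝ) (i : Fin K)
    (t : ℕ) : ℕ :=
  ∑ s ∈ Finset.range t, if phaseAt T tieL tieE u s = some i then 1 else 0

/-- The reward collected from arm `i` while being committed to it. -/
noncomputable def commitReward (T : ℕ) (tieL tieE : TieRule K) (u : Fin K × ℕ → ℝ) (i : Fin K)
    (t : ℕ) : ℝ :=
  ∑ s ∈ Finset.range t,
    if phaseAt T tieL tieE u s = some i then reward (adaETC K T tieL tieE) u s else 0

theorem exploreCount_eq_count {t : ℕ} (h : phaseAt T tieL tieE u t = none) (i : Fin K) :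
    exploreCount T tieL tieE u i t = count (run (adaETC K T tieL tieE) u t) i := by
  induction t with
  | zero => simp [exploreCount, count_run_zero]
  | succ t ih =>
    rw [phaseAt_succ, Option.or_eq_none_iff] at h
    rw [count_run_succ, ← ih h.1, exploreCount, Finset.sum_range_succ, ← exploreCount]
    simp [h.1]

/-- Looks at the exploratory pull of `i` made when its count was `n`. Either it is the initial pull,
`n = 0`, or `i` maximized the UCB at that time and in particular beat `b`. -/
theorem lt_exploreCount (hK : 0 < K) (hT : 0 < T) (b i : Fin K) {t n : ℕ}
    (hn : n < exploreCount T tieL tieE u i t) :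
    n < tau K T ∧ (n = 0 ∨ ∃ m, 1 ≤ m ∧ m ≤ tau K T ∧ ucbTable T u b m ≤ ucbTable T u i n) := by
  induction t with
  | zero => simp [exploreCount] at hn
  | succ t ih =>
    rw [exploreCount, Finset.sum_range_succ, ← exploreCount] at hn
    by_cases hlt : n < exploreCount T tieL tieE u i t
    · exact ih hlt
    · have hc : phaseAt T tieL tieE u t = none ∧
          (adaETC K T tieL tieE).arm t (run (adaETC K T tieL tieE) u t) = i := by
        by_contra hcon
        rw [if_neg hcon] at hn
        omega
      rw [if_pos hc] at hn
      have hn' : n = count (run (adaETC K T tieL tieE) u t) i := by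
        rw [← exploreCount_eq_count hc.1]
        omega
      have hce := count_explore hK hT hc.1
      by_cases ht : t < K
      · have h1 := (hce i).2.1 ht.le
        have h2 := hc.2
        rw [arm_eq_of_lt hc.1 ht] at h2
        have h0 : n = 0 := by
          rw [hn', h1, ← h2]
          simp
        exact ⟨h0 ▸ tau_pos hK hT, Or.inl h0⟩
      · have htK := not_lt.1 ht
        have ha := arm_eq_of_ge hc.1 htK
        rw [hc.2] at ha
        have h1 := count_ucbArm_lt htK (commitTest_eq_none hK hc.1 htK)
        have h2 := ucb_le_ucbArm hK T tieE (run (adaETC K T tieL tieE) u t) b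
        rw [← ha] at h1 h2
        refine ⟨hn' ▸ h1, Or.inr ⟨_, (hce b).2.2 htK, (hce b).1, ?_⟩⟩
        rw [ucb_run hK _ u ((hce b).2.2 htK) (hce b).1,
          ucb_run hK _ u ((hce i).2.2 htK) (hce i).1, ← hn'] at h2
        exact h2

theorem exploreCount_le_tau (hK : 0 < K) (hT : 0 < T) (i : Fin K) (t : ℕ) :
    exploreCount T tieL tieE u i t ≤ tau K T := by
  by_contra h
  exact lt_irrefl _ (lt_exploreCount hK hT i i (not_le.1 h)).1

/-- Commitment is permanent, so at most one arm is ever committed to. The inequality of totals holds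
at the start of the commitment by `commit_start`. It persists because each later round adds the same
reward to `commitReward` and to the total of `i`, leaving `b` untouched. -/
theorem commit_invariant (hK : 2 ≤ K) (hT : 0 < T) (hu : ∀ p, u p ∈ Set.Icc (0 : ℝ) 1)
    (b : Fin K) (t : ℕ) :
    (phaseAt T tieL tieE u t = none → ∀ i, ∀ s < t, phaseAt T tieL tieE u s ≠ some i) ∧
    ∀ i, phaseAt T tieL tieE u t = some i →
      (∀ j, j ≠ i → ∀ s < t, phaseAt T tieL tieE u s ≠ some j) ∧
      (∃ m, 1 ≤ m ∧ m ≤ tau K T ∧ ucbTable T u b m ≤ ucbTable T u i (tau K T)) ∧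
      (i ≠ b → total (run (adaETC K T tieL tieE) u t) b + commitReward T tieL tieE u i t ≤
        total (run (adaETC K T tieL tieE) u t) i) := by
  induction t with
  | zero => simp [phaseAt, phase]
  | succ t ih =>
    constructor
    · intro h i s hs
      rw [phaseAt_succ, Option.or_eq_none_iff] at h
      rcases Nat.lt_succ_iff_lt_or_eq.1 hs with hs | rfl
      · exact ih.1 h.1 i s hs
      · simp [h.1]
    · intro i hi
      cases hp : phaseAt T tieL tieE u t with
      | none =>
        have hno : ∀ j, ∀ s < t + 1, phaseAt T tieL tieE u s ≠ some j := by
          intro j s hs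
          rcases Nat.lt_succ_iff_lt_or_eq.1 hs with hs | rfl
          · exact ih.1 hp j s hs
          · simp [hp]
        obtain ⟨h1, h2⟩ := commit_start hK hT hu hp hi b
        refine ⟨fun j _ => hno j, h1, fun _ => ?_⟩
        have : commitReward T tieL tieE u i (t + 1) = 0 :=
          Finset.sum_eq_zero fun s hs => if_neg (hno i s (Finset.mem_range.1 hs))
        rw [this, add_zero]
        exact h2
      | some k =>
        have hk : k = i := by
          rw [phaseAt_succ, hp, Option.some_or] at hi
          exact Option.some.inj hi
        subst hk
        obtain ⟨h1, h2, h3⟩ := ih.2 k hp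
        refine ⟨fun j hj s hs => ?_, h2, fun hb => ?_⟩
        · rcases Nat.lt_succ_iff_lt_or_eq.1 hs with hs | rfl
          · exact h1 j hj s hs
          · rw [hp]
            exact fun e => hj (Option.some.inj e).symm
        · have ha := arm_eq_of_phaseAt hp
          rw [total_run_succ, total_run_succ, ha, if_neg hb, if_pos rfl, commitReward,
            Finset.sum_range_succ, ← commitReward, if_pos hp]
          linarith [h3 hb]

theorem exists_ucbTable_le_of_commitCount_pos (hK : 2 ≤ K) (hT : 0 < T)
    (hu : ∀ p, u p ∈ Set.Icc (0 : ℝ) 1) (b i : Fin K) {t : ℕ}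
    (h : 0 < commitCount T tieL tieE u i t) :
    ∃ m, 1 ≤ m ∧ m ≤ tau K T ∧ ucbTable T u b m ≤ ucbTable T u i (tau K T) := by
  obtain ⟨s, _, hs⟩ := Finset.exists_ne_zero_of_sum_ne_zero h.ne'
  have : phaseAt T tieL tieE u s = some i := by
    by_contra hc
    simp [hc] at hs
  exact ((commit_invariant hK hT hu b s).2 i this).2.1

/-- At most one summand is nonzero: without a commitment to a suboptimal arm the left side is the
total of `b`, otherwise the total of the committed arm dominates it. -/
theorem total_add_commitReward_le (hK : 2 ≤ K) (hT : 0 < T)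
    (hu : ∀ p, u p ∈ Set.Icc (0 : ℝ) 1) (b : Fin K) (t : ℕ) :
    total (run (adaETC K T tieL tieE) u t) b +
      ∑ i ∈ Finset.univ.erase b, commitReward T tieL tieE u i t ≤
      ⨆ i, total (run (adaETC K T tieL tieE) u t) i := by
  have hle : ∀ i, total (run (adaETC K T tieL tieE) u t) i ≤
      ⨆ i, total (run (adaETC K T tieL tieE) u t) i := fun i =>
    le_ciSup (f := fun i => total (run (adaETC K T tieL tieE) u t) i)
      (Set.finite_range _).bddAbove i
  have hz : ∀ i, (∀ s < t, phaseAt T tieL tieE u s ≠ some i) →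
      commitReward T tieL tieE u i t = 0 := fun i h =>
    Finset.sum_eq_zero fun s hs => if_neg (h s (Finset.mem_range.1 hs))
  have hinv := commit_invariant (tieL := tieL) (tieE := tieE) hK hT hu b t
  cases hp : phaseAt T tieL tieE u t with
  | none =>
    rw [Finset.sum_eq_zero fun i _ => hz i (hinv.1 hp i), add_zero]
    exact hle b
  | some k =>
    obtain ⟨h1, _, h3⟩ := hinv.2 k hp
    by_cases hk : k = b
    · rw [Finset.sum_eq_zero fun i hi => hz i (h1 i (by
        rw [hk]
        exact (Finset.mem_erase.1 hi).1)), add_zero]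
      exact hle b
    · rw [Finset.sum_eq_single k (fun i _ hi => hz i (h1 i hi))
        (fun hn => absurd (Finset.mem_erase.2 ⟨hk, Finset.mem_univ k⟩) hn)]
      exact (h3 hk).trans (hle k)

theorem count_eq_explore_add_commit (i : Fin K) (t : ℕ) :
    count (run (adaETC K T tieL tieE) u t) i =
      exploreCount T tieL tieE u i t + commitCount T tieL tieE u i t := by
  rw [count_run_eq_sum, exploreCount, commitCount, ← Finset.sum_add_distrib]
  refine Finset.sum_congr rfl fun s _ => ?_
  cases hp : phaseAt T tieL tieE u s with
  | none => simp
  | some k => simp [arm_eq_of_phaseAt hp]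

theorem sum_commitCount_le (t : ℕ) : ∑ i, commitCount T tieL tieE u i t ≤ t := by
  calc ∑ i, commitCount T tieL tieE u i t
      ≤ ∑ i, count (run (adaETC K T tieL tieE) u t) i :=
        Finset.sum_le_sum fun i _ => by
          rw [count_eq_explore_add_commit]
          exact Nat.le_add_left _ _
    _ = t := sum_count _

end Paths

/-! ### Decomposition of the regret -/

section Regret

variable {K T : ℕ} {tieL tieE : TieRule K}

theorem measurableSet_phaseAt (t : ℕ) (o : Option (Fin K)) :
    MeasurableSet {u | phaseAt T tieL tieE u t = o} :=
  (measurable_run _ t) (measurableSet_phase tieL tieE t o)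

theorem measurable_exploreCount (i : Fin K) (t : ℕ) :
    Measurable fun u => (exploreCount T tieL tieE u i t : ℝ) := by
  refine measurable_from_top.comp (Finset.measurable_sum _ fun s _ => ?_)
  exact Measurable.ite ((measurableSet_phaseAt s none).inter
    ((((adaETC K T tieL tieE).measurable_arm s).comp (measurable_run _ s))
      (measurableSet_singleton i))) measurable_const measurable_const

theorem measurable_commitCount (i : Fin K) (t : ℕ) :
    Measurable fun u => (commitCount T tieL tieE u i t : ℝ) := by
  refine measurable_from_top.comp (Finset.measurable_sum _ fun s _ => ?_)
  exact Measurable.ite (measurableSet_phaseAt s (some i)) measurable_const measurable_const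

theorem integrable_exploreCount {ν : Fin K → ProbabilityMeasure ℝ} (hν : ν ∈ instances K)
    (i : Fin K) (t : ℕ) :
    Integrable (fun u => (exploreCount T tieL tieE u i t : ℝ)) (tableLaw ν) :=
  integrable_of_bounded hν (measurable_exploreCount i t) t fun u _ => by
    rw [abs_of_nonneg (Nat.cast_nonneg _)]
    have := count_eq_explore_add_commit (T := T) (tieL := tieL) (tieE := tieE) (u := u) i t
    have := count_le (run (adaETC K T tieL tieE) u t) i
    exact_mod_cast (by omega : exploreCount T tieL tieE u i t ≤ t)

theorem integrable_commitCount {ν : Fin K → ProbabilityMeasure ℝ} (hν : ν ∈ instances K)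
    (i : Fin K) (t : ℕ) :
    Integrable (fun u => (commitCount T tieL tieE u i t : ℝ)) (tableLaw ν) :=
  integrable_of_bounded hν (measurable_commitCount i t) t fun u _ => by
    rw [abs_of_nonneg (Nat.cast_nonneg _)]
    have := count_eq_explore_add_commit (T := T) (tieL := tieL) (tieE := tieE) (u := u) i t
    have := count_le (run (adaETC K T tieL tieE) u t) i
    exact_mod_cast (by omega : commitCount T tieL tieE u i t ≤ t)

theorem integrable_commitReward_term {ν : Fin K → ProbabilityMeasure ℝ} (hν : ν ∈ instances K)
    (i : Fin K) (s : ℕ) :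
    Integrable (fun u => if phaseAt T tieL tieE u s = some i then
      reward (adaETC K T tieL tieE) u s else 0) (tableLaw ν) := by
  refine integrable_of_bounded hν (Measurable.ite (measurableSet_phaseAt s (some i))
    (measurable_reward _ s) measurable_const) 1 fun u hu => ?_
  have := reward_mem_Icc (adaETC K T tieL tieE) hu s
  split_ifs
  · exact abs_le.2 ⟨by linarith [this.1], this.2⟩
  · simp

theorem integrable_commitReward {ν : Fin K → ProbabilityMeasure ℝ} (hν : ν ∈ instances K)
    (i : Fin K) (t : ℕ) :
    Integrable (fun u => commitReward T tieL tieE u i t) (tableLaw ν) :=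
  integrable_finsetSum _ fun s _ => integrable_commitReward_term hν i s

/-- Wald's identity restricted to committed rounds: the phase is determined by the history before
the round, so it can serve as the weight in `integral_mul_reward`. -/
theorem integral_commitReward {ν : Fin K → ProbabilityMeasure ℝ} (hν : ν ∈ instances K)
    (i : Fin K) (t : ℕ) :
    ∫ u, commitReward T tieL tieE u i t ∂tableLaw ν =
      mean ν i * ∫ u, (commitCount T tieL tieE u i t : ℝ) ∂tableLaw ν := by
  simp_rw [commitReward, commitCount]
  push_cast
  rw [integral_finsetSum _ fun s _ => integrable_commitReward_term hν i s, integral_finsetSum,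
    Finset.mul_sum]
  · refine Finset.sum_congr rfl fun s _ => ?_
    have hm : Measurable fun h : History K s =>
        if phase T tieL tieE s h = some i then (1 : ℝ) else 0 :=
      Measurable.ite (measurableSet_phase tieL tieE s (some i)) measurable_const measurable_const
    have := integral_mul_reward hν (adaETC K T tieL tieE) s i hm (C := 1)
      (fun h => by split_ifs <;> simp)
    have e : ∀ (u : Fin K × ℕ → ℝ) (x : ℝ),
        (if (adaETC K T tieL tieE).arm s (run (adaETC K T tieL tieE) u s) = i then
          (if phase T tieL tieE s (run (adaETC K T tieL tieE) u s) = some i then (1 : ℝ) else 0) * x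
          else 0) = if phaseAt T tieL tieE u s = some i then x else 0 := by
      intro u x
      by_cases hp : phaseAt T tieL tieE u s = some i
      · have hp' : phase T tieL tieE s (run (adaETC K T tieL tieE) u s) = some i := hp
        simp [arm_eq_of_phaseAt hp, hp, hp']
      · have hp' : ¬ phase T tieL tieE s (run (adaETC K T tieL tieE) u s) = some i := hp
        simp [hp, hp']
    have e1 : ∀ u : Fin K × ℕ → ℝ,
        (if (adaETC K T tieL tieE).arm s (run (adaETC K T tieL tieE) u s) = i then
          (if phase T tieL tieE s (run (adaETC K T tieL tieE) u s) = some i then (1 : ℝ) else 0)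
          else 0) = if phaseAt T tieL tieE u s = some i then 1 else 0 := by
      intro u
      simpa using e u 1
    simp_rw [e, e1] at this
    exact this
  · intro s _
    refine integrable_of_bounded hν (Measurable.ite (measurableSet_phaseAt s (some i))
      measurable_const measurable_const) 1 fun u _ => ?_
    split_ifs <;> simp

/-- Writing `T` as the sum of the expected counts, the pulls of `b` cancel against its own expected
total. For every other arm, an exploratory pull loses `μ_b` and a committed pull loses only `μ_b -
μ_i`, since its reward is kept in the lower bound. -/
theorem regret_adaETC_le (hK : 2 ≤ K) (hT : 0 < T) {ν : Fin K → ProbabilityMeasure ℝ}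
    (hν : ν ∈ instances K) {b : Fin K} (hb : ∀ i, mean ν i ≤ mean ν b) :
    regret T (adaETC K T tieL tieE) ν ≤
      mean ν b * ∑ i ∈ Finset.univ.erase b,
        ∫ u, (exploreCount T tieL tieE u i T : ℝ) ∂tableLaw ν +
      ∫ u, ∑ i ∈ Finset.univ.erase b,
        (mean ν b - mean ν i) * (commitCount T tieL tieE u i T : ℝ) ∂tableLaw ν := by
  set π := adaETC K T tieL tieE
  have hlow : ∫ u, (total (run π u T) b +
      ∑ i ∈ Finset.univ.erase b, commitReward T tieL tieE u i T) ∂tableLaw ν ≤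
      maxReward T π ν := by
    refine integral_mono_ae ((integrable_total hν π T b).add ?_) (integrable_iSup_total hν π T) ?_
    · exact integrable_finsetSum _ fun i _ => integrable_commitReward hν i T
    · filter_upwards [ae_mem_Icc hν] with u hu using total_add_commitReward_le hK hT hu b T
  rw [integral_add (integrable_total hν π T b)
    (integrable_finsetSum _ fun i _ => integrable_commitReward hν i T), integral_total hν,
    integral_finsetSum _ fun i _ => integrable_commitReward hν i T] at hlow
  simp_rw [integral_commitReward hν] at hlow
  have hcount : ∑ i, ∫ u, (count (run π u T) i : ℝ) ∂tableLaw ν = T := by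
    rw [← integral_finsetSum _ fun i _ => integrable_count hν π T i]
    have hc : ∀ u : Fin K × ℕ → ℝ, ∑ i, (count (run π u T) i : ℝ) = T := fun u => by
      exact_mod_cast sum_count (run π u T)
    simp [hc]
  rw [← Finset.add_sum_erase _ _ (Finset.mem_univ b)] at hcount
  have hsplit : ∀ i, ∫ u, (count (run π u T) i : ℝ) ∂tableLaw ν =
      ∫ u, (exploreCount T tieL tieE u i T : ℝ) ∂tableLaw ν +
        ∫ u, (commitCount T tieL tieE u i T : ℝ) ∂tableLaw ν := by
    intro i
    rw [← integral_add (integrable_exploreCount hν i T) (integrable_commitCount hν i T)]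
    congr 1
    funext u
    exact_mod_cast count_eq_explore_add_commit i T
  have hsum : ∑ i ∈ Finset.univ.erase b, ∫ u, (count (run π u T) i : ℝ) ∂tableLaw ν =
      ∑ i ∈ Finset.univ.erase b, ∫ u, (exploreCount T tieL tieE u i T : ℝ) ∂tableLaw ν +
      ∑ i ∈ Finset.univ.erase b, ∫ u, (commitCount T tieL tieE u i T : ℝ) ∂tableLaw ν := by
    rw [← Finset.sum_add_distrib]
    exact Finset.sum_congr rfl fun i _ => hsplit i
  rw [integral_finsetSum _ fun i _ => (integrable_commitCount hν i T).const_mul _]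
  simp_rw [integral_const_mul, sub_mul, Finset.sum_sub_distrib, ← Finset.mul_sum]
  have := regret_le_sub hν hb T π
  rw [← hcount, hsum] at this
  linarith

/-- Covers `K = 1`, which the path analysis excludes and where the worst-case bound is zero because
`log 1 = 0`. -/
theorem regret_nonpos_of_unique [Subsingleton (Fin K)] {ν : Fin K → ProbabilityMeasure ℝ}
    (hν : ν ∈ instances K) (b : Fin K) (π : Policy K) : regret T π ν ≤ 0 := by
  have hb : ∀ i, mean ν i ≤ mean ν b := fun i => by rw [Subsingleton.elim i b]
  have h1 := regret_le_sub hν hb T π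
  have h2 : ∀ u, count (run π u T) b = T := by
    intro u
    have := sum_count (run π u T)
    rwa [Fintype.sum_subsingleton _ b] at this
  have h3 : mean ν b * T ≤ maxReward T π ν := by
    have h4 := integral_total hν π T b
    simp only [h2, integral_const, probReal_univ, one_smul] at h4
    rw [← h4]
    refine integral_mono (integrable_total hν π T b) (integrable_iSup_total hν π T) fun u => ?_
    exact le_ciSup (f := fun i => total (run π u T) i) (Set.finite_range _).bddAbove b
  linarith

end Regret

/-! ### Concentration -/

section Concentration

variable {K : ℕ} {ν : Fin K → ProbabilityMeasure ℝ}

theorem integral_exp_le (hν : ν ∈ instances K) (i : Fin K) (l : ℝ) :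
    ∫ x, Real.exp (l * (x - mean ν i)) ∂(ν i : Measure ℝ) ≤ Real.exp (l ^ 2 / 8) := by
  have h := (ProbabilityTheory.hasSubgaussianMGF_of_mem_Icc (μ := (ν i : Measure ℝ))
    (X := fun x : ℝ => x) measurable_id.aemeasurable (hν i)).mgf_le l
  refine h.trans (le_of_eq ?_)
  congr 1
  simp
  ring

/-- Moment generating function of a predictably sampled sum of centered rewards. -/
theorem integral_exp_predictable_le (hν : ν ∈ instances K) (i : Fin K)
    {w : ℕ → (Fin K × ℕ → ℝ) → ℝ} (hw : ∀ s, Measurable (w s)) (hw' : ∀ s u, w s u = 0 ∨ w s u = 1)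
    (hwu : ∀ s u n, s ≤ n → w s (Function.update u (i, n) 0) = w s u) (l : ℝ) (n : ℕ) :
    Integrable (fun u => Real.exp (l * ∑ s ∈ Finset.range n, w s u * (u (i, s) - mean ν i)))
      (tableLaw ν) ∧
    ∫ u, Real.exp (l * ∑ s ∈ Finset.range n, w s u * (u (i, s) - mean ν i)) ∂tableLaw ν ≤
      Real.exp (n * (l ^ 2 / 8)) := by
  let A : ℕ → (Fin K × ℕ → ℝ) → ℝ := fun n u =>
    ∑ s ∈ Finset.range n, w s u * (u (i, s) - mean ν i)
  have hAm : ∀ n, Measurable (A n) := fun n =>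
    Finset.measurable_sum _ fun s _ => (hw s).mul ((measurable_pi_apply _).sub_const _)
  have hμ := mean_mem_Icc hν i
  have hx : ∀ u : Fin K × ℕ → ℝ, (∀ p, u p ∈ Set.Icc (0 : ℝ) 1) → ∀ s,
      |u (i, s) - mean ν i| ≤ 1 := fun u hu s =>
    abs_le.2 ⟨by linarith [(hu (i, s)).1, hμ.2], by linarith [(hu (i, s)).2, hμ.1]⟩
  have hw1 : ∀ s u, |w s u| ≤ 1 := fun s u => by
    rcases hw' s u with h | h <;> simp [h]
  have hA : ∀ n u, (∀ p, u p ∈ Set.Icc (0 : ℝ) 1) → |A n u| ≤ n := by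
    intro n u hu
    calc |A n u| ≤ ∑ s ∈ Finset.range n, |w s u * (u (i, s) - mean ν i)| :=
          Finset.abs_sum_le_sum_abs _ _
      _ ≤ ∑ s ∈ Finset.range n, 1 := by
          refine Finset.sum_le_sum fun s _ => ?_
          rw [abs_mul]
          exact mul_le_one₀ (hw1 s u) (abs_nonneg _) (hx u hu s)
      _ = n := by simp
  have hE : ∀ n u, (∀ p, u p ∈ Set.Icc (0 : ℝ) 1) →
      |Real.exp (l * A n u)| ≤ Real.exp (|l| * n) := by
    intro n u hu
    rw [abs_of_pos (Real.exp_pos _), Real.exp_le_exp]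
    calc l * A n u ≤ |l * A n u| := le_abs_self _
      _ = |l| * |A n u| := abs_mul _ _
      _ ≤ |l| * n := by gcongr; exact hA n u hu
  have hint : ∀ n, Integrable (fun u => Real.exp (l * A n u)) (tableLaw ν) := fun n =>
    integrable_of_bounded hν ((hAm n).const_mul l).exp _ (hE n)
  refine ⟨hint n, ?_⟩
  change ∫ u, Real.exp (l * A n u) ∂tableLaw ν ≤ _
  induction n with
  | zero => simp [A]
  | succ n ih =>
    -- As `w n` is `0` or `1`, the exponential splits linearly, and the fresh sample `(i, n)`
    -- appears only where `w n = 1`.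
    have hstep : ∀ u, Real.exp (l * A (n + 1) u) =
        Real.exp (l * A n u) * (1 - w n u) +
          Real.exp (l * A n u) * w n u * Real.exp (l * (u (i, n) - mean ν i)) := by
      intro u
      simp only [A, Finset.sum_range_succ]
      rw [mul_add, Real.exp_add]
      rcases hw' n u with h | h <;> simp [h]
    have hb : ∀ u, (∀ p, u p ∈ Set.Icc (0 : ℝ) 1) →
        |Real.exp (l * A n u) * (1 - w n u)| ≤ Real.exp (|l| * n) := by
      intro u hu
      have := hE n u hu
      rcases hw' n u with h | h
      · simpa [h] using this
      · simp [h, Real.exp_nonneg]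
    have hb2 : ∀ u, (∀ p, u p ∈ Set.Icc (0 : ℝ) 1) →
        |Real.exp (l * A n u) * w n u| ≤ Real.exp (|l| * n) := by
      intro u hu
      have := hE n u hu
      rcases hw' n u with h | h
      · simp [h, Real.exp_nonneg]
      · simpa [h] using this
    have hm1 := (((hAm n).const_mul l).exp).mul ((hw n).const_sub 1)
    have hm2 := (((hAm n).const_mul l).exp).mul (hw n)
    have hi1 : Integrable (fun u => Real.exp (l * A n u) * (1 - w n u)) (tableLaw ν) :=
      integrable_of_bounded hν hm1 _ hb
    have hi2 : Integrable (fun u => Real.exp (l * A n u) * w n u) (tableLaw ν) :=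
      integrable_of_bounded hν hm2 _ hb2
    have hφ : Measurable fun x : ℝ => Real.exp (l * (x - mean ν i)) :=
      ((measurable_id.sub_const _).const_mul l).exp
    have hi3 : Integrable (fun u => Real.exp (l * A n u) * w n u *
        Real.exp (l * (u (i, n) - mean ν i))) (tableLaw ν) := by
      refine ((hint (n + 1)).sub hi1).congr (Filter.Eventually.of_forall fun u => ?_)
      simp only [Pi.sub_apply, hstep]
      ring
    have hfresh := integral_mul_fresh ν (i, n) hm2 (fun u => by
      have hAu : A n (Function.update u (i, n) 0) = A n u := by
        refine Finset.sum_congr rfl fun s hs => ?_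
        have hsn := Finset.mem_range.1 hs
        have : ((i, s) : Fin K × ℕ) ≠ (i, n) := fun e => hsn.ne (Prod.mk.inj e).2
        rw [hwu s u n hsn.le, Function.update_of_ne this]
      simp only [hAu, hwu n u n le_rfl, Pi.mul_apply]) hφ
    simp_rw [hstep]
    rw [integral_add hi1 hi3]
    simp only [Pi.mul_apply] at hfresh
    rw [hfresh]
    have hone : (1 : ℝ) ≤ Real.exp (l ^ 2 / 8) := Real.one_le_exp (by positivity)
    have h1 : 0 ≤ ∫ u, Real.exp (l * A n u) * (1 - w n u) ∂tableLaw ν :=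
      integral_nonneg fun u => by
        rcases hw' n u with h | h <;> simp [h, Real.exp_nonneg]
    have h2 : 0 ≤ ∫ u, Real.exp (l * A n u) * w n u ∂tableLaw ν :=
      integral_nonneg fun u => by
        rcases hw' n u with h | h <;> simp [h, Real.exp_nonneg]
    have h3 : ∫ u, Real.exp (l * A n u) ∂tableLaw ν =
        ∫ u, Real.exp (l * A n u) * (1 - w n u) ∂tableLaw ν +
          ∫ u, Real.exp (l * A n u) * w n u ∂tableLaw ν := by
      rw [← integral_add hi1 hi2]
      congr 1
      funext u
      ring
    have h4 := integral_exp_le hν i l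
    calc _ ≤ (∫ u, Real.exp (l * A n u) * (1 - w n u) ∂tableLaw ν) * Real.exp (l ^ 2 / 8) +
          (∫ u, Real.exp (l * A n u) * w n u ∂tableLaw ν) * Real.exp (l ^ 2 / 8) :=
          add_le_add (le_mul_of_one_le_right h1 hone) (mul_le_mul_of_nonneg_left h4 h2)
      _ = (∫ u, Real.exp (l * A n u) ∂tableLaw ν) * Real.exp (l ^ 2 / 8) := by rw [h3, add_mul]
      _ ≤ Real.exp (n * (l ^ 2 / 8)) * Real.exp (l ^ 2 / 8) := by gcongr
      _ = _ := by
          rw [← Real.exp_add]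
          push_cast
          ring_nf

theorem partialSum_sub_eq_sum (u : Fin K × ℕ → ℝ) (i : Fin K) (n : ℕ) (c : ℝ) :
    partialSum u i n - n * c = ∑ s ∈ Finset.range n, (u (i, s) - c) := by
  simp [partialSum, Finset.sum_sub_distrib]

theorem measurable_deviation (i : Fin K) (c σ : ℝ) (m : ℕ) :
    Measurable fun u : Fin K × ℕ → ℝ => σ * (partialSum u i m - m * c) :=
  ((measurable_partialSum i m).sub_const _).const_mul σ

/-- The maximal form of Hoeffding's inequality; `σ = 1` and `σ = -1` give deviations above and
below the mean. -/
theorem measureReal_exists_deviation_le (hν : ν ∈ instances K) (i : Fin K) {σ : ℝ}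
    (hσ : σ ^ 2 = 1) {ε : ℝ} (hε : 0 < ε) {M : ℕ} (hM : 0 < M) :
    (tableLaw ν).real {u | ∃ m ≤ M, ε ≤ σ * (partialSum u i m - m * mean ν i)} ≤
      Real.exp (-(2 * ε ^ 2 / M)) := by
  classical
  let D : ℕ → (Fin K × ℕ → ℝ) → ℝ := fun m u => σ * (partialSum u i m - m * mean ν i)
  have hDm : ∀ m, Measurable (D m) := measurable_deviation i _ σ
  -- The weights stop the sum at the first crossing of `ε`. They are predictable, since `D r` uses
  -- only entries with index below `r`.
  let w : ℕ → (Fin K × ℕ → ℝ) → ℝ := fun s u => if ∀ r ≤ s, D r u < ε then 1 else 0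
  have hw : ∀ s, Measurable (w s) := fun s => by
    refine Measurable.ite ?_ measurable_const measurable_const
    simp only [Set.ofPred_forall]
    exact MeasurableSet.iInter fun r => MeasurableSet.iInter fun _ =>
      measurableSet_lt (hDm r) measurable_const
  have hw' : ∀ s u, w s u = 0 ∨ w s u = 1 := fun s u => by
    simp only [w]
    split_ifs <;> simp
  have hDu : ∀ r u n, r ≤ n → D r (Function.update u (i, n) 0) = D r u := by
    intro r u n hr
    have : partialSum (Function.update u (i, n) 0) i r = partialSum u i r := by
      refine Finset.sum_congr rfl fun s hs => ?_
      have : ((i, s) : Fin K × ℕ) ≠ (i, n) := fun e =>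
        ((Finset.mem_range.1 hs).trans_le hr).ne (Prod.mk.inj e).2
      rw [Function.update_of_ne this]
    simp only [D, this]
  have hwu : ∀ s u n, s ≤ n → w s (Function.update u (i, n) 0) = w s u := by
    intro s u n hs
    have : (∀ r ≤ s, D r (Function.update u (i, n) 0) < ε) ↔ ∀ r ≤ s, D r u < ε :=
      forall₂_congr fun r hr => by rw [hDu r u n (hr.trans hs)]
    simp only [w, this]
  have hM' : (0 : ℝ) < M := by exact_mod_cast hM
  -- Minimizer of the Chernoff exponent `M l² / 8 - l ε`.
  set l : ℝ := 4 * ε / M with hl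
  obtain ⟨hint, hmgf⟩ := integral_exp_predictable_le hν i hw hw' hwu (l * σ) M
  have hsub : {u | ∃ m ≤ M, ε ≤ σ * (partialSum u i m - m * mean ν i)} ⊆
      {u | Real.exp (l * ε) ≤ Real.exp (l * σ *
        ∑ s ∈ Finset.range M, w s u * (u (i, s) - mean ν i))} := by
    intro u hu
    have hex : ∃ m, ε ≤ D m u := by
      obtain ⟨m, _, hm⟩ := hu
      exact ⟨m, hm⟩
    have hfM : Nat.find hex ≤ M := by
      obtain ⟨m, hmM, hm⟩ := hu
      exact (Nat.find_min' hex hm).trans hmM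
    have hA : ∑ s ∈ Finset.range M, w s u * (u (i, s) - mean ν i) =
        ∑ s ∈ Finset.range (Nat.find hex), (u (i, s) - mean ν i) := by
      rw [← Finset.sum_subset (Finset.range_mono hfM)]
      · refine Finset.sum_congr rfl fun s hs => ?_
        have : w s u = 1 := if_pos fun r hr =>
          not_le.1 (Nat.find_min hex (hr.trans_lt (Finset.mem_range.1 hs)))
        rw [this, one_mul]
      · intro s _ hs
        have : w s u = 0 := if_neg fun hc =>
          not_le.2 (hc _ (not_lt.1 fun h => hs (Finset.mem_range.2 h))) (Nat.find_spec hex)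
        rw [this, zero_mul]
    have hfs := Nat.find_spec hex
    change Real.exp _ ≤ Real.exp _
    rw [hA, ← partialSum_sub_eq_sum, mul_assoc, Real.exp_le_exp]
    exact mul_le_mul_of_nonneg_left hfs (by positivity)
  have hmark := mul_meas_ge_le_integral_of_nonneg (μ := tableLaw ν)
    (Filter.Eventually.of_forall fun u => Real.exp_nonneg _) hint (Real.exp (l * ε))
  have hpos := Real.exp_pos (l * ε)
  have h1 : (tableLaw ν).real {u | Real.exp (l * ε) ≤ Real.exp (l * σ *
        ∑ s ∈ Finset.range M, w s u * (u (i, s) - mean ν i))} ≤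
      Real.exp (M * ((l * σ) ^ 2 / 8)) / Real.exp (l * ε) := by
    rw [le_div_iff₀ hpos, mul_comm]
    exact hmark.trans hmgf
  refine (measureReal_mono hsub).trans (h1.trans (le_of_eq ?_))
  rw [← Real.exp_sub, mul_pow, hσ, hl]
  congr 1
  field_simp
  ring

theorem measureReal_deviation_le (hν : ν ∈ instances K) (i : Fin K) {ε : ℝ} (hε : 0 < ε)
    {n : ℕ} (hn : 0 < n) :
    (tableLaw ν).real {u | ε ≤ partialSum u i n - n * mean ν i} ≤
      Real.exp (-(2 * ε ^ 2 / n)) := by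
  refine (measureReal_mono fun u hu => ?_).trans
    (measureReal_exists_deviation_le hν i (σ := 1) (by norm_num) hε hn)
  exact ⟨n, le_rfl, by rw [one_mul]; exact hu⟩

end Concentration

/-! ### The lower tail of the upper confidence bounds -/

/-- The two-case right side is the form that survives the induction `y ↦ 2 y`. Above `1` it is a
geometric series; the crossing case `y ≤ 1 < 2 y` amounts to `(3y - 1)(1 - y) ≥ 0`. -/
theorem sum_min_inv_le (n : ℕ) {y : ℝ} (hy : 0 < y) :
    ∑ j ∈ Finset.range n, min (2 ^ j * y) (2 ^ j * y)⁻¹ ≤ if y ≤ 1 then 4 - 2 * y else 2 / y := by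
  induction n generalizing y with
  | zero =>
    split_ifs
    · simp
      linarith
    · simp
      positivity
  | succ n ih =>
    rw [Finset.sum_range_succ']
    have h := ih (y := 2 * y) (by positivity)
    have e : ∀ j : ℕ, (2 : ℝ) ^ (j + 1) * y = 2 ^ j * (2 * y) := fun j => by ring
    simp only [e, pow_zero, one_mul]
    have hy2 : 2 / (2 * y) = 1 / y := by field_simp
    rw [hy2] at h
    by_cases h1 : y ≤ 1
    · rw [if_pos h1]
      by_cases h2 : 2 * y ≤ 1
      · rw [if_pos h2] at h
        linarith [min_le_left y y⁻¹]
      · rw [if_neg h2] at h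
        have : 1 / y ≤ 4 - 3 * y := by
          rw [div_le_iff₀ hy]
          nlinarith
        linarith [min_le_left y y⁻¹]
    · rw [if_neg h1]
      rw [if_neg (by linarith)] at h
      have : 2 / y = y⁻¹ + 1 / y := by
        field_simp
        norm_num
      linarith [min_le_right y y⁻¹]

theorem sum_min_inv_le_four (n : ℕ) {y : ℝ} (hy : 0 < y) :
    ∑ j ∈ Finset.range n, min (2 ^ j * y) (2 ^ j * y)⁻¹ ≤ 4 := by
  refine (sum_min_inv_le n hy).trans ?_
  split_ifs with h
  · linarith
  · rw [div_le_iff₀ hy]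
    linarith

theorem sqrt_le_half_add_one {y : ℝ} (hy : 0 ≤ y) : Real.sqrt y ≤ (1 + y) / 2 := by
  nlinarith [Real.sq_sqrt hy, sq_nonneg (Real.sqrt y - 1)]

/-- Makes `y^{3/2} e^{-y}` summable over a dyadic grid in both directions. -/
theorem mul_sqrt_mul_exp_neg_le {y : ℝ} (hy : 0 < y) :
    y * Real.sqrt y * Real.exp (-y) ≤ 3 * min y y⁻¹ := by
  have hs := sqrt_le_half_add_one hy.le
  have he : 1 + y + y ^ 2 / 2 + y ^ 3 / 6 ≤ Real.exp y := by
    have := Real.sum_le_exp_of_nonneg hy.le 4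
    simp [Finset.sum_range_succ, Nat.factorial] at this
    linarith
  rw [Real.exp_neg, ← div_eq_mul_inv, div_le_iff₀ (Real.exp_pos y)]
  have hy2 : 0 < y ^ 2 := by positivity
  have hy3 : 0 < y ^ 3 := by positivity
  rcases min_choice y y⁻¹ with h | h <;> rw [h]
  · have : Real.sqrt y ≤ 3 * Real.exp y := by linarith
    calc y * Real.sqrt y ≤ y * (3 * Real.exp y) := by gcongr
      _ = 3 * y * Real.exp y := by ring
  · have : y ^ 2 * Real.sqrt y ≤ 3 * Real.exp y := by
      calc y ^ 2 * Real.sqrt y ≤ y ^ 2 * ((1 + y) / 2) := by gcongr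
        _ ≤ 3 * Real.exp y := by nlinarith
    calc y * Real.sqrt y = y⁻¹ * (y ^ 2 * Real.sqrt y) := by field_simp
      _ ≤ y⁻¹ * (3 * Real.exp y) := by gcongr
      _ = 3 * y⁻¹ * Real.exp y := by ring

theorem rpow_three_halves {y : ℝ} (hy : 0 ≤ y) : y ^ (3 / 2 : ℝ) = y * Real.sqrt y := by
  rw [show (3 / 2 : ℝ) = 1 + 1 / 2 by norm_num, Real.rpow_add' hy (by norm_num), Real.rpow_one,
    Real.sqrt_eq_rpow]

theorem exp_neg_logPlus_le {a : ℝ} (ha : 0 < a) : Real.exp (-logPlus a) ≤ a⁻¹ := by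
  have hm : 0 < max a 1 := lt_max_of_lt_left ha
  rw [logPlus, Real.exp_neg, Real.exp_log hm]
  exact inv_anti₀ ha (le_max_left _ _)

theorem mul_bonus {K T n : ℕ} (hn : 0 < n) :
    n * bonus K T n =
      Real.sqrt (4 * n * logPlus ((T : ℝ) / ((K : ℝ) * (n : ℝ) ^ (3 / 2 : ℝ)))) := by
  have hn' : (0 : ℝ) < n := by exact_mod_cast hn
  rw [bonus, ← Real.sqrt_sq hn'.le, ← Real.sqrt_mul (by positivity), Real.sqrt_sq hn'.le]
  congr 1
  field_simp

/-- The bound on one block of the peeling argument. -/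
theorem exp_block_le {δ x z : ℝ} (hδ : 0 < δ) (hx : 0 < x) (hz : 0 < z) :
    Real.exp (-(2 * (z * x +
      Real.sqrt (4 * z * logPlus (1 / (δ * (2 * z) ^ (3 / 2 : ℝ))))) ^ 2 / (2 * z))) ≤
      9 * (δ / x ^ 3) * min (z * x ^ 2) (z * x ^ 2)⁻¹ := by
  have hpow : (0 : ℝ) < (2 * z) ^ (3 / 2 : ℝ) := by positivity
  have ha : 0 < 1 / (δ * (2 * z) ^ (3 / 2 : ℝ)) := by positivity
  set L := logPlus (1 / (δ * (2 * z) ^ (3 / 2 : ℝ))) with hL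
  have hL0 : 0 ≤ L := logPlus_nonneg _
  have hs := Real.sq_sqrt (show 0 ≤ 4 * z * L by positivity)
  have hs0 := Real.sqrt_nonneg (4 * z * L)
  set r := Real.sqrt (4 * z * L)
  -- The square expands to `z x² + 2 x r + 4 L`, of which only `z x² + L` is kept. The part `z x²`
  -- gives decay and `exp (-L)` gives the factor `δ (2z)^{3/2}`.
  have hexp : -(2 * (z * x + r) ^ 2 / (2 * z)) ≤ -(z * x ^ 2) + -L := by
    have h1 : 2 * (z * x + r) ^ 2 / (2 * z) = z * x ^ 2 + 2 * x * r + r ^ 2 / z := by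
      field_simp
      ring
    have h2 : r ^ 2 / z = 4 * L := by
      rw [hs]
      field_simp
    rw [h1, h2]
    have : 0 ≤ x * r := by positivity
    linarith
  have hsz : Real.sqrt z = Real.sqrt (z * x ^ 2) / x := by
    rw [Real.sqrt_mul hz.le, Real.sqrt_sq hx.le]
    field_simp
  have h32 : (2 * z) ^ (3 / 2 : ℝ) ≤ 3 * (z * x ^ 2 * Real.sqrt (z * x ^ 2)) / x ^ 3 := by
    rw [rpow_three_halves (by positivity), Real.sqrt_mul (by norm_num), hsz]
    have h2 : Real.sqrt 2 ≤ 3 / 2 := by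
      have := sqrt_le_half_add_one (show (0 : ℝ) ≤ 2 by norm_num)
      linarith
    calc 2 * z * (Real.sqrt 2 * (Real.sqrt (z * x ^ 2) / x))
        ≤ 2 * z * (3 / 2 * (Real.sqrt (z * x ^ 2) / x)) := by gcongr
      _ = 3 * (z * x ^ 2 * Real.sqrt (z * x ^ 2)) / x ^ 3 := by field_simp
  have hy : 0 < z * x ^ 2 := by positivity
  calc _ ≤ Real.exp (-(z * x ^ 2) + -L) := Real.exp_le_exp.2 hexp
    _ = Real.exp (-(z * x ^ 2)) * Real.exp (-L) := Real.exp_add _ _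
    _ ≤ Real.exp (-(z * x ^ 2)) * (δ * (2 * z) ^ (3 / 2 : ℝ)) := by
        refine mul_le_mul_of_nonneg_left ?_ (Real.exp_pos _).le
        refine (exp_neg_logPlus_le ha).trans (le_of_eq ?_)
        rw [one_div, inv_inv]
    _ ≤ Real.exp (-(z * x ^ 2)) *
          (δ * (3 * (z * x ^ 2 * Real.sqrt (z * x ^ 2)) / x ^ 3)) := by gcongr
    _ = 3 * (δ / x ^ 3) *
          (z * x ^ 2 * Real.sqrt (z * x ^ 2) * Real.exp (-(z * x ^ 2))) := by ring
    _ ≤ 3 * (δ / x ^ 3) * (3 * min (z * x ^ 2) (z * x ^ 2)⁻¹) := by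
        exact mul_le_mul_of_nonneg_left (mul_sqrt_mul_exp_neg_le hy) (by positivity)
    _ = _ := by ring

/-- The event that an upper confidence bound of arm `b` falls below its mean by at least `x`. -/
def underestimated {K : ℕ} (T : ℕ) (ν : Fin K → ProbabilityMeasure ℝ) (b : Fin K) (x : ℝ) :
    Set (Fin K × ℕ → ℝ) :=
  {u | ∃ m, 1 ≤ m ∧ m ≤ tau K T ∧ ucbTable T u b m ≤ mean ν b - x}

theorem measurable_ucbTable {K : ℕ} (T : ℕ) (i : Fin K) (n : ℕ) :
    Measurable fun u : Fin K × ℕ → ℝ => ucbTable T u i n :=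
  ((measurable_partialSum i n).div_const _).add_const _

theorem measurableSet_underestimated {K : ℕ} (T : ℕ) (ν : Fin K → ProbabilityMeasure ℝ)
    (b : Fin K) (x : ℝ) : MeasurableSet (underestimated T ν b x) := by
  have : underestimated T ν b x =
      ⋃ m ∈ Set.Icc 1 (tau K T), {u | ucbTable T u b m ≤ mean ν b - x} := by
    ext u
    simp [underestimated, and_assoc]
  rw [this]
  exact MeasurableSet.biUnion (Set.to_countable _) fun m _ =>
    measurableSet_le (measurable_ucbTable T b m) measurable_const

/-- Peeling over blocks `2^j ≤ m < 2^{j+1}`: within a block the required deviation is at least `ε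
j`, and the maximal inequality pays once per block. The constant is `9 · 4`, from `exp_block_le` and
`sum_min_inv_le_four`. -/
theorem measureReal_underestimated_le {K T : ℕ} (hK : 0 < K) (hT : 0 < T)
    {ν : Fin K → ProbabilityMeasure ℝ} (hν : ν ∈ instances K) (b : Fin K) {x : ℝ} (hx : 0 < x) :
    (tableLaw ν).real (underestimated T ν b x) ≤ 36 * ((K / T : ℝ) / x ^ 3) := by
  have hK' : (0 : ℝ) < K := by exact_mod_cast hK
  have hT' : (0 : ℝ) < T := by exact_mod_cast hT
  set δ : ℝ := K / T with hδ
  have hδ0 : 0 < δ := by positivity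
  let ε : ℕ → ℝ := fun j => 2 ^ j * x +
    Real.sqrt (4 * 2 ^ j * logPlus (1 / (δ * (2 * 2 ^ j) ^ (3 / 2 : ℝ))))
  let B : ℕ → Set (Fin K × ℕ → ℝ) := fun j =>
    {u | ∃ m ≤ 2 ^ (j + 1), ε j ≤ -1 * (partialSum u b m - m * mean ν b)}
  have hε : ∀ j, 0 < ε j := fun j => by positivity
  have hB : ∀ j, (tableLaw ν).real (B j) ≤
      9 * (δ / x ^ 3) * min (2 ^ j * x ^ 2) (2 ^ j * x ^ 2)⁻¹ := by
    intro j
    refine (measureReal_exists_deviation_le hν b (σ := -1) (by norm_num) (hε j)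
      (M := 2 ^ (j + 1)) (by positivity)).trans ?_
    have := exp_block_le hδ0 hx (z := 2 ^ j) (by positivity)
    have hc : ((2 ^ (j + 1) : ℕ) : ℝ) = 2 * 2 ^ j := by
      push_cast
      ring
    rw [hc]
    exact this
  have hsub : underestimated T ν b x ⊆ ⋃ j ∈ Finset.range (tau K T + 1), B j := by
    rintro u ⟨m, hm1, hmτ, hu⟩
    have hm0 : m ≠ 0 := by omega
    have hlo := Nat.pow_log_le_self 2 hm0
    have hhi := Nat.lt_pow_succ_log_self (b := 2) (by norm_num) m
    set j := Nat.log 2 m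
    refine Set.mem_iUnion₂.2 ⟨j, Finset.mem_range.2 ?_, m, hhi.le, ?_⟩
    · exact Nat.lt_succ_of_le ((Nat.log_le_self 2 m).trans hmτ)
    · have hmpos : (0 : ℝ) < m := by exact_mod_cast hm1
      have hlo' : (2 : ℝ) ^ j ≤ m := by exact_mod_cast hlo
      have hhi' : (m : ℝ) ≤ 2 * 2 ^ j := by
        rw [← pow_succ']
        exact_mod_cast hhi.le
      have h1 : m * x + m * bonus K T m ≤ -1 * (partialSum u b m - m * mean ν b) := by
        rw [ucbTable] at hu
        have := mul_le_mul_of_nonneg_left hu hmpos.le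
        rw [mul_add, mul_div_cancel₀ _ hmpos.ne'] at this
        linarith
      refine le_trans (add_le_add (by gcongr) ?_) h1
      -- The factor `4 m` is bounded below by the left end of the block and the logarithm by its
      -- right end, which explains the mixed `z` and `2 z` in `exp_block_le`.
      rw [mul_bonus (by omega)]
      refine Real.sqrt_le_sqrt (mul_le_mul (by gcongr) (logPlus_mono ?_) (logPlus_nonneg _)
        (by positivity))
      have : (T : ℝ) / (K * (m : ℝ) ^ (3 / 2 : ℝ)) = 1 / (δ * (m : ℝ) ^ (3 / 2 : ℝ)) := by
        rw [hδ]
        field_simp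
      rw [this]
      gcongr
  calc (tableLaw ν).real (underestimated T ν b x)
      ≤ (tableLaw ν).real (⋃ j ∈ Finset.range (tau K T + 1), B j) := measureReal_mono hsub (measure_ne_top _ _)
    _ ≤ ∑ j ∈ Finset.range (tau K T + 1), (tableLaw ν).real (B j) :=
        measureReal_biUnion_finset_le _ _
    _ ≤ ∑ j ∈ Finset.range (tau K T + 1),
          9 * (δ / x ^ 3) * min (2 ^ j * x ^ 2) (2 ^ j * x ^ 2)⁻¹ :=
        Finset.sum_le_sum fun j _ => hB j
    _ = 9 * (δ / x ^ 3) *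
          ∑ j ∈ Finset.range (tau K T + 1), min (2 ^ j * x ^ 2) (2 ^ j * x ^ 2)⁻¹ := by
        rw [Finset.mul_sum]
    _ ≤ 9 * (δ / x ^ 3) * 4 := by
        gcongr
        exact sum_min_inv_le_four _ (by positivity)
    _ = _ := by ring

/-! ### The upper tail of the upper confidence bounds -/

/-- Once `n Δ² ≥ 1 + 16 L`, the bonus is at most `2 √(L / n) ≤ Δ / 2`. Hoeffding then handles what
remains of the margin. -/
theorem measureReal_ucbTable_ge_le {K T : ℕ} (hK : 0 < K) (hT : 0 < T)
    {ν : Fin K → ProbabilityMeasure ℝ} (hν : ν ∈ instances K) (i : Fin K) {Δ : ℝ} (hΔ : 0 < Δ)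
    {n : ℕ} (hn : (1 + 16 * logPlus (T * Δ ^ 3 / K)) / Δ ^ 2 ≤ n) :
    (tableLaw ν).real {u | mean ν i + Δ / 2 ≤ ucbTable T u i n} ≤
      Real.exp (1 / 2 + 4 * Real.sqrt (logPlus (T * Δ ^ 3 / K)) - Δ * Real.sqrt n) := by
  have hK' : (0 : ℝ) < K := by exact_mod_cast hK
  have hT' : (0 : ℝ) < T := by exact_mod_cast hT
  set L := logPlus (T * Δ ^ 3 / K)
  have hL : 0 ≤ L := logPlus_nonneg _
  have hsL := Real.sq_sqrt hL
  have hsL0 := Real.sqrt_nonneg L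
  set q := Real.sqrt L
  have hn0 : (0 : ℝ) < n := lt_of_lt_of_le (by positivity) hn
  have hsn := Real.sq_sqrt hn0.le
  have hsn0 : 0 < Real.sqrt n := Real.sqrt_pos.2 hn0
  set r := Real.sqrt n
  have hΔn : 1 + 16 * L ≤ (Δ * r) ^ 2 := by
    rw [div_le_iff₀ (by positivity)] at hn
    rw [mul_pow, hsn]
    linarith
  have h1 : 1 ≤ Δ * r := by
    nlinarith [show 0 < Δ * r by positivity]
  have h4 : 4 * q ≤ Δ * r := by
    refine abs_le_of_sq_le_sq' ?_ (by positivity) |>.2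
    nlinarith
  have hnb : n * bonus K T n ≤ 2 * q * r := by
    rw [mul_bonus (by exact_mod_cast hn0)]
    rw [show 2 * q * r = Real.sqrt ((2 * q * r) ^ 2) from (Real.sqrt_sq (by positivity)).symm]
    refine Real.sqrt_le_sqrt ?_
    -- Uses `Δ √n ≥ 1`, that is `n^{-3/2} ≤ Δ³`.
    have : logPlus ((T : ℝ) / (K * (n : ℝ) ^ (3 / 2 : ℝ))) ≤ L := by
      refine logPlus_mono ?_
      rw [rpow_three_halves hn0.le, div_le_div_iff₀ (by positivity) hK']
      have e : (n : ℝ) * Real.sqrt n = r ^ 3 := by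
        change (n : ℝ) * r = r ^ 3
        rw [← hsn]
        ring
      rw [e]
      calc (T : ℝ) * K = T * K * 1 ^ 3 := by ring
        _ ≤ T * K * (Δ * r) ^ 3 := by gcongr
        _ = T * Δ ^ 3 * (K * r ^ 3) := by ring
    calc 4 * (n : ℝ) * logPlus ((T : ℝ) / (K * (n : ℝ) ^ (3 / 2 : ℝ))) ≤ 4 * n * L := by gcongr
      _ = (2 * q * r) ^ 2 := by
        rw [← hsn, ← hsL]
        ring
  set v := Δ * r - 4 * q with hv
  have hv0 : 0 ≤ v := by linarith
  rcases hv0.eq_or_lt with hv1 | hv1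
  · refine measureReal_le_one.trans (Real.one_le_exp ?_)
    linarith
  · have hε : 0 < r * v / 2 := by positivity
    have hsub : {u | mean ν i + Δ / 2 ≤ ucbTable T u i n} ⊆
        {u | r * v / 2 ≤ partialSum u i n - n * mean ν i} := by
      intro u hu
      have hu' : mean ν i + Δ / 2 ≤ ucbTable T u i n := hu
      rw [ucbTable] at hu'
      have := mul_le_mul_of_nonneg_left hu' hn0.le
      rw [mul_add (n : ℝ) (_ / _), mul_div_cancel₀ _ hn0.ne'] at this
      change r * v / 2 ≤ _
      have e : r * v / 2 = n * (Δ / 2) - 2 * q * r := by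
        rw [hv, ← hsn]
        ring
      linarith
    refine (measureReal_mono hsub).trans ((measureReal_deviation_le hν i hε
      (by exact_mod_cast hn0)).trans (Real.exp_le_exp.2 ?_))
    have e : 2 * (r * v / 2) ^ 2 / n = v ^ 2 / 2 := by
      rw [← hsn]
      field_simp
    rw [e]
    -- The Gaussian exponent is linearized by `v² / 2 ≥ v - 1 / 2`, so that the sum over `n` can
    -- telescope.
    nlinarith [sq_nonneg (v - 1)]

/-- One step of the telescoping bound for `∑ exp (-Δ √n)`. -/
theorem mul_exp_le_sub {a b : ℝ} (ha : 0 ≤ a) (hab : a ≤ b) :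
    (b ^ 2 - a ^ 2) * Real.exp (-b) ≤
      2 * ((a + 1) * Real.exp (-a)) - 2 * ((b + 1) * Real.exp (-b)) := by
  -- The right side of the goal is the integral of `2 x e^{-x}` from `a` to `b`, and the left side
  -- replaces `e^{-x}` by its smallest value there.
  have h := Real.quadratic_le_exp_of_nonneg (sub_nonneg.2 hab)
  have e : Real.exp (-a) = Real.exp (b - a) * Real.exp (-b) := by
    rw [← Real.exp_add]
    ring_nf
  have h2 : (b ^ 2 - a ^ 2) + 2 * (b + 1) ≤ 2 * ((a + 1) * Real.exp (b - a)) := by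
    have := mul_le_mul_of_nonneg_left h (show 0 ≤ 2 * (a + 1) by linarith)
    have h3 : 0 ≤ a * (b - a) ^ 2 := by positivity
    nlinarith
  have := mul_le_mul_of_nonneg_right h2 (Real.exp_pos (-b)).le
  rw [e]
  linarith

theorem add_one_mul_exp_neg_le {c A : ℝ} (hc : 0 ≤ c) (h : c ≤ A) :
    (A + 1) * Real.exp (-A) ≤ (c + 1) * Real.exp (-c) := by
  have h1 := Real.add_one_le_exp (A - c)
  have e : Real.exp (-c) = Real.exp (A - c) * Real.exp (-A) := by
    rw [← Real.exp_add]
    ring_nf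
  rw [e, ← mul_assoc]
  refine mul_le_mul_of_nonneg_right ?_ (Real.exp_pos _).le
  have := mul_le_mul_of_nonneg_left h1 (show 0 ≤ c + 1 by linarith)
  nlinarith [mul_nonneg hc (sub_nonneg.2 h)]

theorem sum_measureReal_ucbTable_ge_le {K T : ℕ} (hK : 0 < K) (hT : 0 < T)
    {ν : Fin K → ProbabilityMeasure ℝ} (hν : ν ∈ instances K) (i : Fin K) {Δ : ℝ} (hΔ : 0 < Δ)
    (hΔ1 : Δ ≤ 1) (N : ℕ) :
    1 + ∑ n ∈ Finset.Ico 1 N, (tableLaw ν).real {u | mean ν i + Δ / 2 ≤ ucbTable T u i n} ≤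
      10 / Δ ^ 2 + 16 / Δ ^ 2 * logPlus (T * Δ ^ 3 / K) +
        24 / Δ ^ 2 * Real.sqrt (logPlus (T * Δ ^ 3 / K)) := by
  set L := logPlus (T * Δ ^ 3 / K) with hLdef
  have hL : 0 ≤ L := logPlus_nonneg _
  set q := Real.sqrt L
  have hq : 0 ≤ q := Real.sqrt_nonneg _
  have hqL : q ^ 2 = L := Real.sq_sqrt hL
  let p : ℕ → ℝ := fun n => (tableLaw ν).real {u | mean ν i + Δ / 2 ≤ ucbTable T u i n}
  have hp0 : ∀ n, 0 ≤ p n := fun n => measureReal_nonneg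
  -- The first `a` probabilities are bounded by `1`; the tail bound is applied to the later ones.
  set a : ℕ := ⌊(1 + 16 * L) / Δ ^ 2⌋₊ + 1 with ha
  have ha1 : (1 + 16 * L) / Δ ^ 2 ≤ a := by
    rw [ha]
    push_cast
    exact (Nat.lt_floor_add_one _).le
  have ha2 : (a : ℝ) ≤ (1 + 16 * L) / Δ ^ 2 + 1 := by
    rw [ha]
    push_cast
    linarith [Nat.floor_le (show 0 ≤ (1 + 16 * L) / Δ ^ 2 by positivity)]
  let F : ℕ → ℝ := fun n => 2 / Δ ^ 2 * ((Δ * Real.sqrt n + 1) * Real.exp (-(Δ * Real.sqrt n)))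
  have hF0 : ∀ n, 0 ≤ F n := fun n => by positivity
  set E := Real.exp (1 / 2 + 4 * q) with hE
  have hstep : ∀ n : ℕ, (1 + 16 * L) / Δ ^ 2 ≤ n → p (n + 1) ≤ E * (F n - F (n + 1)) := by
    intro n hn
    have h1 := measureReal_ucbTable_ge_le hK hT hν i hΔ (n := n + 1)
      (hn.trans (by push_cast; linarith))
    rw [← hLdef] at h1
    have h2 := mul_exp_le_sub (a := Δ * Real.sqrt n) (b := Δ * Real.sqrt ((n + 1 : ℕ) : ℝ))
      (by positivity) (by gcongr; simp)
    have e1 : (Δ * Real.sqrt ((n + 1 : ℕ) : ℝ)) ^ 2 - (Δ * Real.sqrt n) ^ 2 = Δ ^ 2 := by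
      rw [mul_pow, mul_pow, Real.sq_sqrt (by positivity), Real.sq_sqrt (by positivity)]
      push_cast
      ring
    rw [e1] at h2
    have h3 : Real.exp (-(Δ * Real.sqrt ((n + 1 : ℕ) : ℝ))) ≤ F n - F (n + 1) := by
      have : F n - F (n + 1) = (2 * ((Δ * Real.sqrt n + 1) * Real.exp (-(Δ * Real.sqrt n))) -
          2 * ((Δ * Real.sqrt ((n + 1 : ℕ) : ℝ) + 1) *
            Real.exp (-(Δ * Real.sqrt ((n + 1 : ℕ) : ℝ))))) / Δ ^ 2 := by
        simp only [F]
        ring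
      rw [this, le_div_iff₀ (by positivity), mul_comm]
      exact h2
    calc p (n + 1) ≤ Real.exp (1 / 2 + 4 * q - Δ * Real.sqrt ((n + 1 : ℕ) : ℝ)) := h1
      _ = E * Real.exp (-(Δ * Real.sqrt ((n + 1 : ℕ) : ℝ))) := by
          rw [hE, ← Real.exp_add]
          ring_nf
      _ ≤ E * (F n - F (n + 1)) := by gcongr
  have hsum : ∀ k : ℕ, ∑ n ∈ Finset.Ico 1 (a + 1 + k), p n ≤ a + E * (F a - F (a + k)) := by
    intro k
    induction k with
    | zero =>
      calc ∑ n ∈ Finset.Ico 1 (a + 1), p n ≤ ∑ n ∈ Finset.Ico 1 (a + 1), (1 : ℝ) :=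
            Finset.sum_le_sum fun n _ => measureReal_le_one
        _ = a + E * (F a - F (a + 0)) := by simp
    | succ k ih =>
      rw [← add_assoc, Finset.sum_Ico_succ_top (by omega)]
      have hk : (1 + 16 * L) / Δ ^ 2 ≤ ((a + k : ℕ) : ℝ) := by
        push_cast
        linarith [Nat.cast_nonneg (α := ℝ) k]
      have := hstep (a + k) hk
      rw [show a + 1 + k = a + k + 1 by ring] at ih ⊢
      rw [← add_assoc]
      linarith
  have hA : 4 * q ≤ Δ * Real.sqrt a := by
    refine abs_le_of_sq_le_sq' ?_ (by positivity) |>.2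
    rw [mul_pow, mul_pow, hqL, Real.sq_sqrt (Nat.cast_nonneg _)]
    rw [div_le_iff₀ (by positivity)] at ha1
    linarith
  have hehalf : Real.exp (1 / 2) ≤ 2 := by
    have h1 : Real.exp (1 / 2) ^ 2 = Real.exp 1 := by
      rw [← Real.exp_nat_mul]
      norm_num
    have h2 := Real.exp_one_lt_d9
    nlinarith [Real.exp_pos (1 / 2 : ℝ)]
  -- The factor `exp (4 q)` in `E` cancels because `Δ √a ≥ 4 q` and `(x + 1) e^{-x}` decreases; `exp
  -- (1/2) ≤ 2` gives the constants.
  have hEF : E * F a ≤ (4 + 16 * q) / Δ ^ 2 := by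
    have h1 := add_one_mul_exp_neg_le (c := 4 * q) (by positivity) hA
    calc E * F a ≤ E * (2 / Δ ^ 2 * ((4 * q + 1) * Real.exp (-(4 * q)))) := by
          simp only [F]
          gcongr
      _ = Real.exp (1 / 2) * (Real.exp (4 * q) * Real.exp (-(4 * q))) *
            (2 / Δ ^ 2 * (4 * q + 1)) := by
          rw [hE, Real.exp_add]
          ring
      _ = Real.exp (1 / 2) * (2 / Δ ^ 2 * (4 * q + 1)) := by
          rw [← Real.exp_add, add_neg_cancel, Real.exp_zero, mul_one]
      _ ≤ 2 * (2 / Δ ^ 2 * (4 * q + 1)) := by gcongr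
      _ = (4 + 16 * q) / Δ ^ 2 := by ring
  have hfin : ∑ n ∈ Finset.Ico 1 N, p n ≤ a + E * F a := by
    calc ∑ n ∈ Finset.Ico 1 N, p n ≤ ∑ n ∈ Finset.Ico 1 (a + 1 + N), p n :=
          Finset.sum_le_sum_of_subset_of_nonneg (Finset.Ico_subset_Ico_right (by omega))
            fun n _ _ => hp0 n
      _ ≤ a + E * (F a - F (a + N)) := hsum N
      _ ≤ a + E * F a := by
          have : 0 ≤ E * F (a + N) := mul_nonneg (Real.exp_pos _).le (hF0 _)
          linarith
  have hone : 1 ≤ 1 / Δ ^ 2 := by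
    rw [le_div_iff₀ (by positivity)]
    nlinarith
  calc _ ≤ 1 + (a + E * F a) := by
        have := hfin
        simp only [p] at this
        linarith
    _ ≤ 1 / Δ ^ 2 + (((1 + 16 * L) / Δ ^ 2 + 1 / Δ ^ 2) + (4 + 16 * q) / Δ ^ 2) := by linarith
    _ = (7 + 16 * L + 16 * q) / Δ ^ 2 := by ring
    _ ≤ (10 + 16 * L + 24 * q) / Δ ^ 2 := by
        gcongr
        · norm_num
        · norm_num
    _ = _ := by ring

/-! ### The instance-dependent bound -/

section InstanceBound

variable {K T : ℕ} {tieL tieE : TieRule K}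

theorem integral_ite_mem {Ω : Type*} [MeasurableSpace Ω] (μ : Measure Ω) {S : Set Ω}
    [DecidablePred (· ∈ S)] (hS : MeasurableSet S) :
    ∫ u, (if u ∈ S then (1 : ℝ) else 0) ∂μ = μ.real S := by
  rw [← integral_indicator_one hS]
  congr 1
  funext u
  by_cases h : u ∈ S <;> simp [h]

theorem integrable_ite_mem {Ω : Type*} [MeasurableSpace Ω] (μ : Measure Ω) [IsFiniteMeasure μ]
    {S : Set Ω} [DecidablePred (· ∈ S)] (hS : MeasurableSet S) :
    Integrable (fun u => if u ∈ S then (1 : ℝ) else 0) μ := by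
  refine Integrable.of_bound
    (Measurable.ite hS measurable_const measurable_const).aestronglyMeasurable 1 ?_
  refine Filter.Eventually.of_forall fun u => ?_
  split_ifs <;> simp

theorem measurableSet_le_ucbTable (T : ℕ) (i : Fin K) (n : ℕ) (c : ℝ) :
    MeasurableSet {u : Fin K × ℕ → ℝ | c ≤ ucbTable T u i n} :=
  measurableSet_le measurable_const (measurable_ucbTable T i n)

open Classical in
-- If `b` is underestimated, the trivial bound `τ` is used. Otherwise every exploratory pull after
-- the initial one, which accounts for the `1`, needs a high UCB of `i` at its own count.
theorem exploreCount_le (hK : 0 < K) (hT : 0 < T) (ν : Fin K → ProbabilityMeasure ℝ)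
    (b i : Fin K) (x : ℝ) (u : Fin K × ℕ → ℝ) (t : ℕ) :
    (exploreCount T tieL tieE u i t : ℝ) ≤
      tau K T * (if u ∈ underestimated T ν b x then 1 else 0) +
        (1 + ∑ n ∈ Finset.Ico 1 (tau K T),
          if u ∈ {u | mean ν b - x ≤ ucbTable T u i n} then 1 else 0) := by
  have hnn : (0 : ℝ) ≤ 1 + ∑ n ∈ Finset.Ico 1 (tau K T),
      if u ∈ {u | mean ν b - x ≤ ucbTable T u i n} then 1 else 0 :=
    add_nonneg zero_le_one (Finset.sum_nonneg fun n _ => by split_ifs <;> simp)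
  by_cases hG : u ∈ underestimated T ν b x
  · rw [if_pos hG, mul_one]
    have : (exploreCount T tieL tieE u i t : ℝ) ≤ tau K T := by
      exact_mod_cast exploreCount_le_tau hK hT i t
    linarith
  · rw [if_neg hG, mul_zero, zero_add]
    have hN := exploreCount_le_tau (tieL := tieL) (tieE := tieE) (u := u) hK hT i t
    set N := exploreCount T tieL tieE u i t with hNdef
    have hgood : ∀ n ∈ Finset.Ico 1 N,
        (1 : ℝ) ≤ if u ∈ {u | mean ν b - x ≤ ucbTable T u i n} then 1 else 0 := by
      intro n hn
      obtain ⟨h1, h2⟩ := Finset.mem_Ico.1 hn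
      rcases (lt_exploreCount hK hT b i (hNdef ▸ h2)).2 with h0 | ⟨m, hm1, hm2, hm⟩
      · omega
      · rw [if_pos]
        have : ¬ ucbTable T u b m ≤ mean ν b - x := fun hc => hG ⟨m, hm1, hm2, hc⟩
        exact (not_le.1 this).le.trans hm
    calc (N : ℝ) ≤ 1 + ∑ n ∈ Finset.Ico 1 N, (1 : ℝ) := by
          simp only [Finset.sum_const, Nat.card_Ico, nsmul_eq_mul, mul_one]
          exact_mod_cast (by omega : N ≤ 1 + (N - 1))
      _ ≤ 1 + ∑ n ∈ Finset.Ico 1 N,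
            if u ∈ {u | mean ν b - x ≤ ucbTable T u i n} then 1 else 0 := by
          gcongr with n hn
          exact hgood n hn
      _ ≤ _ := by
          gcongr 1 + ?_
          refine Finset.sum_le_sum_of_subset_of_nonneg (Finset.Ico_subset_Ico_right hN) ?_
          intro n _ _
          split_ifs <;> simp

theorem integral_exploreCount_le (hK : 0 < K) (hT : 0 < T) {ν : Fin K → ProbabilityMeasure ℝ}
    (hν : ν ∈ instances K) (b i : Fin K) (hΔ : 0 < mean ν b - mean ν i) (t : ℕ) :
    ∫ u, (exploreCount T tieL tieE u i t : ℝ) ∂tableLaw ν ≤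
      min (10 / (mean ν b - mean ν i) ^ 2 + 16 / (mean ν b - mean ν i) ^ 2 *
          logPlus (T * (mean ν b - mean ν i) ^ 3 / K)
        + 24 / (mean ν b - mean ν i) ^ 2 *
          Real.sqrt (logPlus (T * (mean ν b - mean ν i) ^ 3 / K))) (tau K T : ℝ) +
      tau K T * (tableLaw ν).real (underestimated T ν b ((mean ν b - mean ν i) / 2)) := by
  classical
  set Δ := mean ν b - mean ν i with hΔdef
  have hΔ1 : Δ ≤ 1 := by
    linarith [(mean_mem_Icc hν b).2, (mean_mem_Icc hν i).1]
  have hthr : mean ν b - Δ / 2 = mean ν i + Δ / 2 := by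
    rw [hΔdef]
    ring
  have hτ := tau_pos hK hT
  have hGm := measurableSet_underestimated T ν b (Δ / 2)
  have hint : ∀ n, Integrable (fun u =>
      if u ∈ {u | mean ν b - Δ / 2 ≤ ucbTable T u i n} then (1 : ℝ) else 0) (tableLaw ν) :=
    fun n => integrable_ite_mem _ (measurableSet_le_ucbTable T i n _)
  have hint' : Integrable (fun u => 1 + ∑ n ∈ Finset.Ico 1 (tau K T),
      if u ∈ {u | mean ν b - Δ / 2 ≤ ucbTable T u i n} then (1 : ℝ) else 0) (tableLaw ν) :=
    (integrable_const _).add (integrable_finsetSum _ fun n _ => hint n)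
  have hle : ∫ u, (exploreCount T tieL tieE u i t : ℝ) ∂tableLaw ν ≤
      ∫ u, (tau K T * (if u ∈ underestimated T ν b (Δ / 2) then (1 : ℝ) else 0) +
        (1 + ∑ n ∈ Finset.Ico 1 (tau K T),
          if u ∈ {u | mean ν b - Δ / 2 ≤ ucbTable T u i n} then (1 : ℝ) else 0)) ∂tableLaw ν := by
    refine integral_mono (integrable_exploreCount hν i t) ?_
      fun u => exploreCount_le hK hT ν b i (Δ / 2) u t
    exact ((integrable_ite_mem _ hGm).const_mul _).add hint'
  rw [integral_add ((integrable_ite_mem _ hGm).const_mul _) hint',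
    integral_const_mul, integral_ite_mem _ hGm,
    integral_add (integrable_const _) (integrable_finsetSum _ fun n _ => hint n),
    integral_finsetSum _ fun n _ => hint n] at hle
  simp_rw [integral_ite_mem (tableLaw ν) (measurableSet_le_ucbTable T i _ _), hthr] at hle
  simp only [integral_const, probReal_univ, one_smul] at hle
  have h1 := sum_measureReal_ucbTable_ge_le hK hT hν i hΔ hΔ1 (tau K T)
  have h2 : 1 + ∑ n ∈ Finset.Ico 1 (tau K T),
      (tableLaw ν).real {u | mean ν i + Δ / 2 ≤ ucbTable T u i n} ≤ (tau K T : ℝ) := by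
    calc _ ≤ 1 + ∑ n ∈ Finset.Ico 1 (tau K T), (1 : ℝ) := by
          gcongr with n _
          exact measureReal_le_one
      _ = (tau K T : ℝ) := by
          simp [Nat.cast_sub (show 1 ≤ tau K T from hτ)]
  linarith [le_min h1 h2]

theorem underestimated_anti (ν : Fin K → ProbabilityMeasure ℝ) (b : Fin K) {x y : ℝ}
    (h : x ≤ y) : underestimated T ν b y ⊆ underestimated T ν b x := by
  rintro u ⟨m, h1, h2, h3⟩
  exact ⟨m, h1, h2, by linarith⟩

theorem measureReal_underestimated_half_le (hK : 0 < K) (hT : 0 < T)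
    {ν : Fin K → ProbabilityMeasure ℝ} (hν : ν ∈ instances K) (b : Fin K) {Δ : ℝ} (hΔ : 0 < Δ) :
    (tableLaw ν).real (underestimated T ν b (Δ / 2)) ≤ min 1 (320 * K / (T * Δ ^ 3)) := by
  have hK' : (0 : ℝ) < K := by exact_mod_cast hK
  have hT' : (0 : ℝ) < T := by exact_mod_cast hT
  refine le_min measureReal_le_one ?_
  refine (measureReal_underestimated_le hK hT hν b (half_pos hΔ)).trans ?_
  -- Halving the gap multiplies the constant `36` by `8`; the result `288` is below the `320` of the
  -- theorem.
  rw [show 36 * ((K / T : ℝ) / (Δ / 2) ^ 3) = 288 * K / (T * Δ ^ 3) by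
    field_simp
    norm_num]
  gcongr
  norm_num

theorem measureReal_overestimated_le (hK : 0 < K) (hT : 0 < T)
    {ν : Fin K → ProbabilityMeasure ℝ} (hν : ν ∈ instances K) (i : Fin K) {Δ : ℝ} (hΔ : 0 < Δ) :
    (tableLaw ν).real {u | mean ν i + Δ / 2 ≤ ucbTable T u i (tau K T)} ≤
      Real.exp (-(tau K T * Δ ^ 2 / 2)) := by
  have hτ := tau_pos hK hT
  have hτ' : (0 : ℝ) < tau K T := by exact_mod_cast hτ
  have hsub : {u | mean ν i + Δ / 2 ≤ ucbTable T u i (tau K T)} ⊆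
      {u | tau K T * (Δ / 2) ≤ partialSum u i (tau K T) - tau K T * mean ν i} := by
    intro u hu
    have hu' : mean ν i + Δ / 2 ≤ ucbTable T u i (tau K T) := hu
    rw [ucbTable, bonus_tau hK, add_zero, le_div_iff₀ hτ'] at hu'
    simp only [Set.mem_ofPred_eq]
    linarith
  refine (measureReal_mono hsub).trans
    ((measureReal_deviation_le hν i (by positivity) hτ).trans (le_of_eq ?_))
  congr 2
  field_simp

/-! ### Summation by parts over the sorted gaps. -/

theorem sum_erase_perm {k : ℕ} (σ : Equiv.Perm (Fin (k + 1))) (f : Fin (k + 1) → ℝ) :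
    ∑ i ∈ Finset.univ.erase (σ 0), f i = ∑ l : Fin k, f (σ l.succ) := by
  have h1 := Finset.add_sum_erase Finset.univ f (Finset.mem_univ (σ 0))
  rw [← Equiv.sum_comp σ f, Fin.sum_univ_succ] at h1
  linarith

theorem sum_sub_castSucc {k : ℕ} (D : Fin (k + 1) → ℝ) (h0 : D 0 = 0) (j : Fin (k + 1)) :
    D j = ∑ l : Fin k, if l.succ ≤ j then D l.succ - D l.castSucc else 0 := by
  induction j using Fin.induction with
  | zero => simp [h0, Fin.succ_ne_zero]
  | succ i ih =>
    have : ∀ l : Fin k, (if l.succ ≤ i.succ then D l.succ - D l.castSucc else 0) =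
        (if l.succ ≤ i.castSucc then D l.succ - D l.castSucc else 0) +
          if l = i then D l.succ - D l.castSucc else 0 := by
      intro l
      by_cases hl : l = i
      · subst hl
        simp
      · have : l.succ ≤ i.succ ↔ l.succ ≤ i.castSucc := by
          have : l.val ≠ i.val := fun e => hl (Fin.ext e)
          simp only [Fin.le_def, Fin.val_succ, Fin.val_castSucc]
          omega
        simp [hl, this]
    simp_rw [this, Finset.sum_add_distrib, ← ih]
    simp

open Classical in
-- If the committed arm is not overestimated at `τ` pulls, then `b` is underestimated by half its
-- gap. Nestedness of these events bounds that gap by a quantity `W` common to all arms, and since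
-- the commit counts sum to at most `T`, the cost is `W T` with no extra factor `K`.
theorem sum_gap_mul_commitCount_le {k T : ℕ} {tieL tieE : TieRule (k + 1)} (hk : 0 < k)
    (hT : 0 < T) (ν : Fin (k + 1) → ProbabilityMeasure ℝ) (σ : Equiv.Perm (Fin (k + 1)))
    (hanti : Antitone fun i => mean ν (σ i)) {u : Fin (k + 1) × ℕ → ℝ}
    (hu : ∀ p, u p ∈ Set.Icc (0 : ℝ) 1) :
    ∑ i ∈ Finset.univ.erase (σ 0),
      (mean ν (σ 0) - mean ν i) * (commitCount T tieL tieE u i T : ℝ) ≤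
    ∑ l : Fin k, (mean ν (σ 0) - mean ν (σ l.succ)) * T *
      (if u ∈ {u | mean ν (σ l.succ) + (mean ν (σ 0) - mean ν (σ l.succ)) / 2 ≤
        ucbTable T u (σ l.succ) (tau (k + 1) T)} then 1 else 0) +
    ∑ l : Fin k, ((mean ν (σ 0) - mean ν (σ l.succ)) - (mean ν (σ 0) - mean ν (σ l.castSucc))) * T *
      (if u ∈ underestimated T ν (σ 0) ((mean ν (σ 0) - mean ν (σ l.succ)) / 2) then 1 else 0) := by
  set D : Fin (k + 1) → ℝ := fun i => mean ν (σ 0) - mean ν (σ i) with hD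
  have hDmono : Monotone D := fun i j h => sub_le_sub_left (hanti h) _
  have hD0 : D 0 = 0 := sub_self _
  have hDnn : ∀ i, 0 ≤ D i := fun i => hD0 ▸ hDmono (Fin.zero_le i)
  have hdn : ∀ l : Fin k, 0 ≤ D l.succ - D l.castSucc := fun l =>
    sub_nonneg.2 (hDmono (Fin.castSucc_lt_succ).le)
  -- By telescoping, `W` dominates every gap `D j` for which `b` is underestimated by `D j / 2`.
  set W : ℝ := ∑ l : Fin k, (D l.succ - D l.castSucc) *
      (if u ∈ underestimated T ν (σ 0) (D l.succ / 2) then 1 else 0) with hW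
  have hW0 : 0 ≤ W := Finset.sum_nonneg fun l _ => mul_nonneg (hdn l) (by split_ifs <;> simp)
  have hWj : ∀ j, u ∈ underestimated T ν (σ 0) (D j / 2) → D j ≤ W := by
    intro j hj
    rw [sum_sub_castSucc D hD0 j]
    refine Finset.sum_le_sum fun l _ => ?_
    by_cases hl : l.succ ≤ j
    · rw [if_pos hl, if_pos (underestimated_anti ν (σ 0) (by linarith [hDmono hl]) hj), mul_one]
    · rw [if_neg hl]
      exact mul_nonneg (hdn l) (by split_ifs <;> simp)
  rw [sum_erase_perm σ fun i => (mean ν (σ 0) - mean ν i) * (commitCount T tieL tieE u i T : ℝ)]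
  have hterm : ∀ l : Fin k, D l.succ * (commitCount T tieL tieE u (σ l.succ) T : ℝ) ≤
      D l.succ * T * (if u ∈ {u | mean ν (σ l.succ) + D l.succ / 2 ≤
        ucbTable T u (σ l.succ) (tau (k + 1) T)} then 1 else 0) +
      W * (commitCount T tieL tieE u (σ l.succ) T : ℝ) := by
    intro l
    have hC0 : (0 : ℝ) ≤ commitCount T tieL tieE u (σ l.succ) T := Nat.cast_nonneg _
    have hCT : (commitCount T tieL tieE u (σ l.succ) T : ℝ) ≤ T := by
      exact_mod_cast (Finset.single_le_sum (f := fun i => commitCount T tieL tieE u i T)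
        (fun _ _ => Nat.zero_le _) (Finset.mem_univ (σ l.succ))).trans (sum_commitCount_le T)
    have hWC := mul_nonneg hW0 hC0
    split_ifs with hbad
    · have := mul_le_mul_of_nonneg_left hCT (hDnn l.succ)
      linarith
    · rw [mul_zero, zero_add]
      rcases Nat.eq_zero_or_pos (commitCount T tieL tieE u (σ l.succ) T) with h0 | hpos
      · simp [h0]
      · obtain ⟨m, hm1, hm2, hm⟩ :=
          exists_ucbTable_le_of_commitCount_pos (by omega) hT hu (σ 0) _ hpos
        refine mul_le_mul_of_nonneg_right (hWj _ ⟨m, hm1, hm2, hm.trans ?_⟩) hC0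
        have : ucbTable T u (σ l.succ) (tau (k + 1) T) < mean ν (σ l.succ) + D l.succ / 2 :=
          not_le.1 hbad
        simp only [hD] at this ⊢
        linarith
  have hCsum : ∑ l : Fin k, (commitCount T tieL tieE u (σ l.succ) T : ℝ) ≤ T := by
    rw [← sum_erase_perm σ fun i => (commitCount T tieL tieE u i T : ℝ)]
    refine (Finset.sum_le_sum_of_subset_of_nonneg (Finset.erase_subset _ _)
      fun _ _ _ => Nat.cast_nonneg _).trans ?_
    exact_mod_cast sum_commitCount_le T
  calc _ ≤ ∑ l : Fin k, (D l.succ * T * (if u ∈ {u | mean ν (σ l.succ) + D l.succ / 2 ≤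
        ucbTable T u (σ l.succ) (tau (k + 1) T)} then 1 else 0) +
      W * (commitCount T tieL tieE u (σ l.succ) T : ℝ)) := Finset.sum_le_sum fun l _ => hterm l
    _ = ∑ l : Fin k, D l.succ * T * (if u ∈ {u | mean ν (σ l.succ) + D l.succ / 2 ≤
        ucbTable T u (σ l.succ) (tau (k + 1) T)} then 1 else 0) +
      W * ∑ l : Fin k, (commitCount T tieL tieE u (σ l.succ) T : ℝ) := by
        rw [Finset.sum_add_distrib, Finset.mul_sum]
    _ ≤ ∑ l : Fin k, D l.succ * T * (if u ∈ {u | mean ν (σ l.succ) + D l.succ / 2 ≤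
        ucbTable T u (σ l.succ) (tau (k + 1) T)} then 1 else 0) + W * T := by gcongr
    _ = _ := by
        congr 1
        rw [hW, Finset.sum_mul]
        exact Finset.sum_congr rfl fun l _ => by ring

theorem regret_le_instanceBound {k T : ℕ} (hT : 0 < T) (tieL tieE : TieRule (k + 1))
    {ν : Fin (k + 1) → ProbabilityMeasure ℝ} (hν : ν ∈ instances (k + 1))
    (σ : Equiv.Perm (Fin (k + 1))) (hlt : ∀ i, i ≠ 0 → mean ν (σ i) < mean ν (σ 0))
    (hanti : Antitone fun i => mean ν (σ i)) :
    regret T (adaETC (k + 1) T tieL tieE) ν ≤ instanceBound k T fun i => mean ν (σ i) := by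
  classical
  rcases Nat.eq_zero_or_pos k with rfl | hk
  · have : Subsingleton (Fin (0 + 1)) := inferInstanceAs (Subsingleton (Fin 1))
    have := regret_nonpos_of_unique (T := T) hν 0 (adaETC (0 + 1) T tieL tieE)
    simpa [instanceBound] using this
  have hK : 2 ≤ k + 1 := by omega
  have hK0 : 0 < k + 1 := by omega
  have hb : ∀ i, mean ν i ≤ mean ν (σ 0) := fun i => by
    have := hanti (Fin.zero_le (σ.symm i))
    simpa using this
  have hμ0 := (mean_mem_Icc hν (σ 0)).1
  set D : Fin (k + 1) → ℝ := fun i => mean ν (σ 0) - mean ν (σ i) with hD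
  have hDpos : ∀ l : Fin k, 0 < D l.succ := fun l => sub_pos.2 (hlt _ (Fin.succ_ne_zero l))
  have hdn : ∀ l : Fin k, 0 ≤ D l.succ - D l.castSucc := fun l =>
    sub_nonneg.2 (sub_le_sub_left (hanti (Fin.castSucc_lt_succ).le) _)
  have hreg := regret_adaETC_le (tieL := tieL) (tieE := tieE) hK hT hν hb
  rw [sum_erase_perm σ] at hreg
  have hexp : ∀ l : Fin k, ∫ u, (exploreCount T tieL tieE u (σ l.succ) T : ℝ) ∂tableLaw ν ≤
      min (10 / D l.succ ^ 2 + 16 / D l.succ ^ 2 * logPlus (T * D l.succ ^ 3 / (k + 1 : ℕ))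
        + 24 / D l.succ ^ 2 * Real.sqrt (logPlus (T * D l.succ ^ 3 / (k + 1 : ℕ))))
        (tau (k + 1) T : ℝ) +
      tau (k + 1) T * min 2 (648 * (k + 1 : ℕ) / (T * D l.succ ^ 3)) := by
    intro l
    refine (integral_exploreCount_le hK0 hT hν (σ 0) (σ l.succ) (hDpos l) T).trans ?_
    gcongr
    refine (measureReal_underestimated_half_le hK0 hT hν (σ 0) (hDpos l)).trans ?_
    have := hDpos l
    refine min_le_min (by norm_num) ?_
    gcongr
    norm_num
  have hSm : ∀ l : Fin k, MeasurableSet {u : Fin (k + 1) × ℕ → ℝ | mean ν (σ l.succ) + D l.succ / 2 ≤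
      ucbTable T u (σ l.succ) (tau (k + 1) T)} := fun l => measurableSet_le_ucbTable T _ _ _
  have hGm := fun l : Fin k => measurableSet_underestimated T ν (σ 0) (D l.succ / 2)
  have hi1 : ∀ l : Fin k, Integrable (fun u => D l.succ * T *
      (if u ∈ {u | mean ν (σ l.succ) + D l.succ / 2 ≤
        ucbTable T u (σ l.succ) (tau (k + 1) T)} then (1 : ℝ) else 0)) (tableLaw ν) := fun l =>
    (integrable_ite_mem _ (hSm l)).const_mul _
  have hi2 : ∀ l : Fin k, Integrable (fun u => (D l.succ - D l.castSucc) * T *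
      (if u ∈ underestimated T ν (σ 0) (D l.succ / 2) then (1 : ℝ) else 0)) (tableLaw ν) := fun l =>
    (integrable_ite_mem _ (hGm l)).const_mul _
  have hcom : ∫ u, ∑ i ∈ Finset.univ.erase (σ 0),
      (mean ν (σ 0) - mean ν i) * (commitCount T tieL tieE u i T : ℝ) ∂tableLaw ν ≤
      ∑ l : Fin k, Real.exp (-(tau (k + 1) T * D l.succ ^ 2 / 2)) * T * D l.succ +
      ∑ l : Fin k, min 1 (320 * (k + 1 : ℕ) / (T * D l.succ ^ 3)) * T *
        (D l.succ - D l.castSucc) := by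
    calc _ ≤ ∫ u, (∑ l : Fin k, D l.succ * T *
            (if u ∈ {u | mean ν (σ l.succ) + D l.succ / 2 ≤
              ucbTable T u (σ l.succ) (tau (k + 1) T)} then (1 : ℝ) else 0) +
          ∑ l : Fin k, (D l.succ - D l.castSucc) * T *
            (if u ∈ underestimated T ν (σ 0) (D l.succ / 2) then (1 : ℝ) else 0)) ∂tableLaw ν := by
          refine integral_mono_ae
            (integrable_finsetSum _ fun i _ => (integrable_commitCount hν i T).const_mul _)
            ((integrable_finsetSum _ fun l _ => hi1 l).add
              (integrable_finsetSum _ fun l _ => hi2 l)) ?_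
          filter_upwards [ae_mem_Icc hν] with u hu
          exact sum_gap_mul_commitCount_le hk hT ν σ hanti hu
      _ = ∑ l : Fin k, D l.succ * T * (tableLaw ν).real {u | mean ν (σ l.succ) + D l.succ / 2 ≤
              ucbTable T u (σ l.succ) (tau (k + 1) T)} +
          ∑ l : Fin k, (D l.succ - D l.castSucc) * T *
            (tableLaw ν).real (underestimated T ν (σ 0) (D l.succ / 2)) := by
          rw [integral_add (integrable_finsetSum _ fun l _ => hi1 l)
            (integrable_finsetSum _ fun l _ => hi2 l), integral_finsetSum _ fun l _ => hi1 l,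
            integral_finsetSum _ fun l _ => hi2 l]
          simp_rw [integral_const_mul, integral_ite_mem _ (hSm _), integral_ite_mem _ (hGm _)]
      _ ≤ _ := by
          refine add_le_add (Finset.sum_le_sum fun l _ => ?_) (Finset.sum_le_sum fun l _ => ?_)
          · have h1 := measureReal_overestimated_le hK0 hT hν (σ l.succ) (hDpos l)
            have := mul_le_mul_of_nonneg_left h1
              (mul_nonneg (hDpos l).le (Nat.cast_nonneg (α := ℝ) T))
            linarith
          · have h1 := measureReal_underestimated_half_le hK0 hT hν (σ 0) (hDpos l)
            have := mul_le_mul_of_nonneg_left h1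
              (mul_nonneg (hdn l) (Nat.cast_nonneg (α := ℝ) T))
            linarith
  have h1 := mul_le_mul_of_nonneg_left (Finset.sum_le_sum fun l (_ : l ∈ Finset.univ) => hexp l) hμ0
  rw [Finset.sum_add_distrib, ← Finset.mul_sum, mul_add, ← mul_assoc (mean ν (σ 0)) (tau _ _ : ℝ)]
    at h1
  refine hreg.trans ((add_le_add h1 hcom).trans (le_of_eq ?_))
  exact (add_assoc _ _ _).symm

end InstanceBound

/-! ### The worst-case bound -/

section WorstCase

variable {K T : ℕ} {tieL tieE : TieRule K}

/-- A dyadic layer-cake bound: if `a 2^n < d ≤ a 2^{n+1}`, all levels up to `n` are active and the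
right side is at least `a + a (2^{n+1} - 1)`. It turns tail bounds into a bound on the expected
underestimate. -/
theorem le_add_sum_two_pow {a d : ℝ} (P : ℝ → Prop) [DecidablePred P] (ha : 0 < a)
    (hP : ∀ x ≤ d, P x) (n : ℕ) (h : d ≤ a * 2 ^ n) :
    d ≤ a + ∑ l ∈ Finset.range n, a * 2 ^ l * if P (a * 2 ^ l) then 1 else 0 := by
  induction n with
  | zero => simpa using h
  | succ n ih =>
    by_cases hd : d ≤ a * 2 ^ n
    · rw [Finset.sum_range_succ, ← add_assoc]
      have h0 : 0 ≤ a * 2 ^ n * (if P (a * 2 ^ n) then (1 : ℝ) else 0) :=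
        mul_nonneg (by positivity) (by split_ifs <;> simp)
      linarith [ih hd]
    · have hall : ∀ l ∈ Finset.range (n + 1),
          a * 2 ^ l * (if P (a * 2 ^ l) then (1 : ℝ) else 0) = a * 2 ^ l := by
        intro l hl
        rw [if_pos, mul_one]
        refine hP _ (le_trans ?_ (not_le.1 hd).le)
        gcongr
        · norm_num
        · exact Nat.lt_succ_iff.1 (Finset.mem_range.1 hl)
      rw [Finset.sum_congr rfl hall, ← Finset.mul_sum, geom_sum_eq (by norm_num)]
      linarith

theorem sum_quarter_pow_le (n : ℕ) : ∑ l ∈ Finset.range n, (1 / 4 : ℝ) ^ l ≤ 4 / 3 := by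
  rw [geom_sum_eq (by norm_num)]
  have : (0 : ℝ) ≤ (1 / 4) ^ n := by positivity
  rw [div_le_iff_of_neg (by norm_num)]
  linarith

/-- A soft maximum: summing the exponentials over the arms bounds the largest error by something
whose expectation is computed arm by arm. -/
theorem le_add_exp {l : ℝ} (hl : 0 < l) (e α : ℝ) : e ≤ α + 1 / l * Real.exp (l * e - l * α) := by
  have := Real.add_one_le_exp (l * e - l * α)
  have h2 : l * (e - α) ≤ Real.exp (l * e - l * α) := by linarith
  have h3 : e - α ≤ Real.exp (l * e - l * α) / l := by
    rw [le_div_iff₀ hl]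
    linarith
  rw [div_mul_eq_mul_div, one_mul]
  linarith

/-- The sum of the centered rewards of the first `τ` pulls of arm `i`, divided by `τ`. -/
noncomputable def meanError (T : ℕ) (ν : Fin K → ProbabilityMeasure ℝ) (u : Fin K × ℕ → ℝ)
    (i : Fin K) : ℝ :=
  (tau K T : ℝ)⁻¹ * ∑ s ∈ Finset.range (tau K T), 1 * (u (i, s) - mean ν i)

theorem ucbTable_tau (hK : 0 < K) (hT : 0 < T) (ν : Fin K → ProbabilityMeasure ℝ)
    (u : Fin K × ℕ → ℝ) (i : Fin K) :
    ucbTable T u i (tau K T) = mean ν i + meanError T ν u i := by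
  have hτ : (0 : ℝ) < tau K T := by exact_mod_cast tau_pos hK hT
  simp only [one_mul, meanError]
  rw [ucbTable, bonus_tau hK, add_zero, ← partialSum_sub_eq_sum]
  field_simp
  ring

theorem integral_exp_meanError_le (hK : 0 < K) (hT : 0 < T) {ν : Fin K → ProbabilityMeasure ℝ}
    (hν : ν ∈ instances K) (i : Fin K) (l c : ℝ) :
    Integrable (fun u => Real.exp (l * meanError T ν u i - c)) (tableLaw ν) ∧
      ∫ u, Real.exp (l * meanError T ν u i - c) ∂tableLaw ν ≤
        Real.exp (l ^ 2 / (8 * tau K T) - c) := by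
  have hτ : (0 : ℝ) < tau K T := by exact_mod_cast tau_pos hK hT
  -- No stopping is needed here, since the sample size is the fixed number `τ`; all weights are `1`.
  obtain ⟨h1, h2⟩ := integral_exp_predictable_le hν i (w := fun _ _ => 1)
    (fun _ => measurable_const) (fun _ _ => Or.inr rfl) (fun _ _ _ _ => rfl)
    (l * (tau K T : ℝ)⁻¹) (tau K T)
  have e : ∀ u : Fin K × ℕ → ℝ, Real.exp (l * meanError T ν u i - c) =
      Real.exp (l * (tau K T : ℝ)⁻¹ *
        ∑ s ∈ Finset.range (tau K T), 1 * (u (i, s) - mean ν i)) * Real.exp (-c) := by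
    intro u
    rw [← Real.exp_add, meanError, ← mul_assoc, sub_eq_add_neg]
  simp_rw [e]
  refine ⟨h1.mul_const _, ?_⟩
  rw [integral_mul_const, sub_eq_add_neg, Real.exp_add]
  gcongr
  refine h2.trans (le_of_eq ?_)
  congr 1
  field_simp

open Classical in
-- Commitment gives `UCB_b(m) ≤ μ_i + error_i`, hence `μ_b - μ_i ≤ (μ_b - UCB_b(m)) + error_i`. The
-- two terms are bounded by the layer cake and by the soft maximum, uniformly in `i`.
theorem gap_le_of_commitCount_pos (hK : 2 ≤ K) (hT : 0 < T) (ν : Fin K → ProbabilityMeasure ℝ)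
    (hν : ν ∈ instances K) (b i : Fin K) {u : Fin K × ℕ → ℝ}
    (hu : ∀ p, u p ∈ Set.Icc (0 : ℝ) 1) {t : ℕ} (h : 0 < commitCount T tieL tieE u i t)
    {a : ℝ} (ha : 0 < a) {n : ℕ} (hn : 1 ≤ a * 2 ^ n) {l : ℝ} (hl : 0 < l) (α : ℝ) :
    mean ν b - mean ν i ≤
      (a + ∑ j ∈ Finset.range n, a * 2 ^ j *
        if u ∈ underestimated T ν b (a * 2 ^ j) then 1 else 0) +
      (α + 1 / l * ∑ i, Real.exp (l * meanError T ν u i - l * α)) := by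
  have hK0 : 0 < K := by omega
  obtain ⟨m, hm1, hm2, hm⟩ := exists_ucbTable_le_of_commitCount_pos hK hT hu b i h
  rw [ucbTable_tau hK0 hT ν] at hm
  have hU : 0 ≤ ucbTable T u b m :=
    add_nonneg (div_nonneg (Finset.sum_nonneg fun s _ => (hu _).1) (Nat.cast_nonneg _))
      (bonus_nonneg K T m)
  have hd1 : mean ν b - ucbTable T u b m ≤ a * 2 ^ n := by
    linarith [(mean_mem_Icc hν b).2]
  have hd := le_add_sum_two_pow (fun x => u ∈ underestimated T ν b x) ha
    (d := mean ν b - ucbTable T u b m)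
    (fun x hx => ⟨m, hm1, hm2, by linarith⟩) n hd1
  have he := le_add_exp hl (meanError T ν u i) α
  have hs : Real.exp (l * meanError T ν u i - l * α) ≤
      ∑ i, Real.exp (l * meanError T ν u i - l * α) :=
    Finset.single_le_sum (f := fun i => Real.exp (l * meanError T ν u i - l * α))
      (fun _ _ => Real.exp_nonneg _) (Finset.mem_univ i)
  have hs' := mul_le_mul_of_nonneg_left hs (show 0 ≤ 1 / l by positivity)
  linarith

theorem integral_gap_mul_commitCount_le (hK : 2 ≤ K) (hT : 0 < T)
    {ν : Fin K → ProbabilityMeasure ℝ} (hν : ν ∈ instances K) {b : Fin K} {ρ : ℝ} (hρ : 0 < ρ)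
    (hρ3 : ρ ^ 3 = K / T) (hρτ : 1 ≤ ρ ^ 2 * tau K T) :
    ∫ u, ∑ i ∈ Finset.univ.erase b,
      (mean ν b - mean ν i) * (commitCount T tieL tieE u i T : ℝ) ∂tableLaw ν ≤
      T * (49 * ρ + 2 * Real.sqrt (Real.log K) * ρ) := by
  classical
  have hK0 : 0 < K := by omega
  have hKpos : (0 : ℝ) < K := by exact_mod_cast hK0
  have hτ : (0 : ℝ) < tau K T := by exact_mod_cast tau_pos hK0 hT
  obtain ⟨n, hn⟩ : ∃ n : ℕ, 1 ≤ ρ * 2 ^ n := by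
    obtain ⟨n, hn⟩ := pow_unbounded_of_one_lt (1 / ρ) (one_lt_two (α := ℝ))
    refine ⟨n, ?_⟩
    rw [div_lt_iff₀ hρ] at hn
    linarith
  set L := Real.log K with hL
  have hL2 : 1 / 2 ≤ L := by
    have h1 : Real.log 2 ≤ L := Real.log_le_log (by norm_num) (by exact_mod_cast hK)
    linarith [Real.log_two_gt_d9]
  -- With this `l` and `l α = 2 L`, each exponential has expectation at most `exp (L - 2 L) = 1 /
  -- K`, so the `K` of them sum to at most `1`.
  set l := Real.sqrt (8 * tau K T * L) with hl
  have hl2 : l ^ 2 = 8 * tau K T * L := Real.sq_sqrt (by positivity)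
  have hl0 : 0 < l := Real.sqrt_pos.2 (by positivity)
  set α := 2 * L / l with hα
  have hlα : l * α = 2 * L := by
    rw [hα]
    field_simp
  have hGm := fun j : ℕ => measurableSet_underestimated T ν b (ρ * 2 ^ j)
  let Y : (Fin K × ℕ → ℝ) → ℝ := fun u => ρ + ∑ j ∈ Finset.range n, ρ * 2 ^ j *
    if u ∈ underestimated T ν b (ρ * 2 ^ j) then 1 else 0
  let Z : (Fin K × ℕ → ℝ) → ℝ := fun u => α + 1 / l *
    ∑ i, Real.exp (l * meanError T ν u i - l * α)
  have hYi : ∀ j, Integrable (fun u => ρ * 2 ^ j *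
      if u ∈ underestimated T ν b (ρ * 2 ^ j) then (1 : ℝ) else 0) (tableLaw ν) := fun j =>
    (integrable_ite_mem _ (hGm j)).const_mul _
  have hYint : Integrable Y (tableLaw ν) :=
    (integrable_const _).add (integrable_finsetSum _ fun j _ => hYi j)
  have hZi := fun i => (integral_exp_meanError_le hK0 hT hν i l (l * α)).1
  have hZint : Integrable Z (tableLaw ν) :=
    (integrable_const _).add ((integrable_finsetSum _ fun i _ => hZi i).const_mul _)
  -- Level `j` contributes at most `36 ρ / 4^j`, because `K / T = ρ³`; hence `49 = 1 + 36 · 4 / 3`.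
  have hY : ∫ u, Y u ∂tableLaw ν ≤ 49 * ρ := by
    have hterm : ∀ j : ℕ, ∫ u, ρ * 2 ^ j *
        (if u ∈ underestimated T ν b (ρ * 2 ^ j) then (1 : ℝ) else 0) ∂tableLaw ν ≤
        36 * ρ * (1 / 4) ^ j := by
      intro j
      rw [integral_const_mul, integral_ite_mem _ (hGm j)]
      have h := measureReal_underestimated_le hK0 hT hν b (x := ρ * 2 ^ j) (by positivity)
      rw [← hρ3] at h
      calc ρ * 2 ^ j * (tableLaw ν).real (underestimated T ν b (ρ * 2 ^ j))
          ≤ ρ * 2 ^ j * (36 * (ρ ^ 3 / (ρ * 2 ^ j) ^ 3)) := by gcongr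
        _ = 36 * ρ * (1 / 4) ^ j := by
            rw [one_div, inv_pow, show (4 : ℝ) = 2 ^ 2 by norm_num, ← pow_mul, mul_comm 2 j,
              pow_mul]
            field_simp
    simp only [Y]
    rw [integral_add (integrable_const _) (integrable_finsetSum _ fun j _ => hYi j),
      integral_finsetSum _ fun j _ => hYi j]
    simp only [integral_const, probReal_univ, one_smul]
    calc _ ≤ ρ + ∑ j ∈ Finset.range n, 36 * ρ * (1 / 4) ^ j := by
          gcongr with j _
          exact hterm j
      _ = ρ + 36 * ρ * ∑ j ∈ Finset.range n, (1 / 4 : ℝ) ^ j := by rw [Finset.mul_sum]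
      _ ≤ ρ + 36 * ρ * (4 / 3) := by
          gcongr
          exact sum_quarter_pow_le n
      _ = 49 * ρ := by ring
  have hZ : ∫ u, Z u ∂tableLaw ν ≤ 2 * Real.sqrt L * ρ := by
    have hterm : ∀ i, ∫ u, Real.exp (l * meanError T ν u i - l * α) ∂tableLaw ν ≤ 1 / K := by
      intro i
      refine (integral_exp_meanError_le hK0 hT hν i l (l * α)).2.trans (le_of_eq ?_)
      rw [hlα, hl2, show 8 * (tau K T : ℝ) * L / (8 * tau K T) = L by field_simp,
        show L - 2 * L = -L by ring, Real.exp_neg, hL, Real.exp_log hKpos, one_div]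
    simp only [Z]
    rw [integral_add (integrable_const _) ((integrable_finsetSum _ fun i _ => hZi i).const_mul _),
      integral_const_mul, integral_finsetSum _ fun i _ => hZi i]
    simp only [integral_const, probReal_univ, one_smul]
    have hsum : ∑ i, ∫ u, Real.exp (l * meanError T ν u i - l * α) ∂tableLaw ν ≤ 1 := by
      calc _ ≤ ∑ _i : Fin K, (1 / K : ℝ) := Finset.sum_le_sum fun i _ => hterm i
        _ = 1 := by
            simp
            field_simp
    have hL0 : 0 ≤ L := by linarith
    have hsL := Real.sq_sqrt hL0
    have hsLpos : 0 < Real.sqrt L := Real.sqrt_pos.2 (by linarith)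
    have hlρ : 2 * Real.sqrt L ≤ l * ρ := by
      refine abs_le_of_sq_le_sq' ?_ (by positivity) |>.2
      rw [mul_pow, mul_pow, hsL, hl2]
      nlinarith
    -- `L ≥ 1/2` absorbs the `1` in `2 L + 1`, and `l ρ ≥ 2 √L` comes from `ρ² τ ≥ 1`.
    calc _ ≤ α + 1 / l * 1 := by gcongr
      _ = (2 * L + 1) / l := by
          rw [hα]
          ring
      _ ≤ 4 * L / l := by
          gcongr
          linarith
      _ ≤ 2 * Real.sqrt L * ρ := by
          rw [div_le_iff₀ hl0]
          nlinarith
  have hpath : ∀ u : Fin K × ℕ → ℝ, (∀ p, u p ∈ Set.Icc (0 : ℝ) 1) →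
      ∑ i ∈ Finset.univ.erase b,
        (mean ν b - mean ν i) * (commitCount T tieL tieE u i T : ℝ) ≤ T * (Y u + Z u) := by
    intro u hu
    have hYZ : 0 ≤ Y u + Z u := by positivity
    calc _ ≤ ∑ i ∈ Finset.univ.erase b, (Y u + Z u) * (commitCount T tieL tieE u i T : ℝ) := by
          refine Finset.sum_le_sum fun i _ => ?_
          rcases Nat.eq_zero_or_pos (commitCount T tieL tieE u i T) with h0 | hpos
          · simp [h0]
          · exact mul_le_mul_of_nonneg_right
              (gap_le_of_commitCount_pos hK hT ν hν b i hu hpos hρ hn hl0 α) (Nat.cast_nonneg _)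
      _ = (Y u + Z u) * ∑ i ∈ Finset.univ.erase b, (commitCount T tieL tieE u i T : ℝ) := by
          rw [Finset.mul_sum]
      _ ≤ (Y u + Z u) * T := by
          gcongr
          refine (Finset.sum_le_sum_of_subset_of_nonneg (Finset.erase_subset _ _)
            fun _ _ _ => Nat.cast_nonneg _).trans ?_
          exact_mod_cast sum_commitCount_le T
      _ = _ := mul_comm _ _
  calc _ ≤ ∫ u, T * (Y u + Z u) ∂tableLaw ν := by
        refine integral_mono_ae
          (integrable_finsetSum _ fun i _ => (integrable_commitCount hν i T).const_mul _)
          ((hYint.add hZint).const_mul _) ?_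
        filter_upwards [ae_mem_Icc hν] with u hu using hpath u hu
    _ = T * (∫ u, Y u ∂tableLaw ν + ∫ u, Z u ∂tableLaw ν) := by
        rw [integral_const_mul, integral_add hYint hZint]
    _ ≤ _ := by gcongr

theorem regret_le_worstCase (hK : 1 ≤ K) (hKT : K < T) (tieL tieE : TieRule K)
    {ν : Fin K → ProbabilityMeasure ℝ} (hν : ν ∈ instances K) :
    regret T (adaETC K T tieL tieE) ν ≤
      104 * ((K : ℝ) ^ (1 / 3 : ℝ) * (T : ℝ) ^ (2 / 3 : ℝ) * Real.sqrt (Real.log (K : ℝ))) := by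
  have hT : 0 < T := by omega
  have hne : Nonempty (Fin K) := ⟨⟨0, hK⟩⟩
  rcases hK.eq_or_lt with rfl | hK2
  · simpa using regret_nonpos_of_unique (T := T) hν 0 (adaETC 1 T tieL tieE)
  obtain ⟨b, hb⟩ := Finite.exists_max (mean ν)
  have hKpos : (0 : ℝ) < K := by exact_mod_cast hK
  have hTpos : (0 : ℝ) < T := by exact_mod_cast hT
  set x := (K : ℝ) ^ (1 / 3 : ℝ) with hx
  set y := (T : ℝ) ^ (1 / 3 : ℝ) with hy
  have hx0 : 0 < x := by positivity
  have hy0 : 0 < y := by positivity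
  have hx3 : x ^ 3 = K := by
    rw [hx, ← Real.rpow_natCast, ← Real.rpow_mul hKpos.le]
    norm_num
  have hy3 : y ^ 3 = T := by
    rw [hy, ← Real.rpow_natCast, ← Real.rpow_mul hTpos.le]
    norm_num
  have hx2 : (K : ℝ) ^ (2 / 3 : ℝ) = x ^ 2 := by
    rw [hx, ← Real.rpow_natCast, ← Real.rpow_mul hKpos.le]
    norm_num
  have hy2 : (T : ℝ) ^ (2 / 3 : ℝ) = y ^ 2 := by
    rw [hy, ← Real.rpow_natCast, ← Real.rpow_mul hTpos.le]
    norm_num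
  -- `K < T` absorbs the rounding in `τ`: it adds `K = x³ ≤ x y²` to the exploration cost.
  have hxy : x ≤ y := Real.rpow_le_rpow hKpos.le (by exact_mod_cast hKT.le) (by norm_num)
  have hτ1 : y ^ 2 / x ^ 2 ≤ tau K T := by
    rw [tau, hx2, hy2]
    exact Nat.le_ceil _
  have hτ2 : (tau K T : ℝ) ≤ y ^ 2 / x ^ 2 + 1 := by
    rw [tau, hx2, hy2]
    exact (Nat.ceil_lt_add_one (by positivity)).le
  have hcom := integral_gap_mul_commitCount_le (tieL := tieL) (tieE := tieE) (b := b) hK2 hT hν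
    (ρ := x / y) (by positivity) (by rw [div_pow, hx3, hy3]) (by
      calc (1 : ℝ) = (x / y) ^ 2 * (y ^ 2 / x ^ 2) := by field_simp
        _ ≤ (x / y) ^ 2 * tau K T := by gcongr)
  have hexp : mean ν b * ∑ i ∈ Finset.univ.erase b,
      ∫ u, (exploreCount T tieL tieE u i T : ℝ) ∂tableLaw ν ≤ 2 * (x * y ^ 2) := by
    have h1 : ∀ i, ∫ u, (exploreCount T tieL tieE u i T : ℝ) ∂tableLaw ν ≤ tau K T := by
      intro i
      calc _ ≤ ∫ _, (tau K T : ℝ) ∂tableLaw ν :=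
            integral_mono (integrable_exploreCount hν i T) (integrable_const _) fun u =>
              Nat.cast_le.2 (exploreCount_le_tau hK hT i T)
        _ = tau K T := by simp
    have h0 : ∀ i, 0 ≤ ∫ u, (exploreCount T tieL tieE u i T : ℝ) ∂tableLaw ν := fun i =>
      integral_nonneg fun u => Nat.cast_nonneg _
    calc _ ≤ 1 * ∑ i, ∫ u, (exploreCount T tieL tieE u i T : ℝ) ∂tableLaw ν := by
          refine mul_le_mul (mean_mem_Icc hν b).2 ?_ (Finset.sum_nonneg fun i _ => h0 i) zero_le_one
          exact Finset.sum_le_sum_of_subset_of_nonneg (Finset.erase_subset _ _) fun i _ _ => h0 i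
      _ ≤ 1 * ∑ _i : Fin K, (tau K T : ℝ) := by
          gcongr with i
          exact h1 i
      _ = x ^ 3 * tau K T := by simp [hx3]
      _ ≤ x ^ 3 * (y ^ 2 / x ^ 2 + 1) := by gcongr
      _ = x * y ^ 2 + x * x ^ 2 := by field_simp
      _ ≤ x * y ^ 2 + x * y ^ 2 := by gcongr
      _ = 2 * (x * y ^ 2) := by ring
  have hs : 1 / 2 ≤ Real.sqrt (Real.log K) := by
    have h1 : Real.log 2 ≤ Real.log K := Real.log_le_log (by norm_num) (by exact_mod_cast hK2)
    refine Real.le_sqrt_of_sq_le ?_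
    linarith [Real.log_two_gt_d9]
  set s := Real.sqrt (Real.log K)
  have hTxy : (T : ℝ) * (x / y) = x * y ^ 2 := by
    rw [← hy3]
    field_simp
  rw [hy2]
  calc _ ≤ 2 * (x * y ^ 2) + T * (49 * (x / y) + 2 * s * (x / y)) :=
        (regret_adaETC_le hK2 hT hν hb).trans (add_le_add hexp hcom)
    _ = (51 + 2 * s) * (T * (x / y)) + 2 * (x * y ^ 2 - T * (x / y)) := by ring
    _ = (51 + 2 * s) * (x * y ^ 2) := by
        rw [hTxy]
        ring
    -- `51 + 2 s ≤ 104 s` because `s ≥ 1/2`, which holds since `K ≥ 2`.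
    _ ≤ (104 * s) * (x * y ^ 2) := by
        gcongr
        linarith
    _ = _ := by ring

end WorstCase

end Bandit

theorem theorem3 :
    (∀ (k T : ℕ), k + 1 < T →
      ∀ (tieL tieE : Bandit.TieRule (k + 1)),
      ∀ ν ∈ Bandit.instances (k + 1),
      ∀ σ : Equiv.Perm (Fin (k + 1)),
        (∀ i, i ≠ 0 → Bandit.mean ν (σ i) < Bandit.mean ν (σ 0)) →
        Antitone (fun i => Bandit.mean ν (σ i)) →
        Bandit.regret T (Bandit.adaETC (k + 1) T tieL tieE) ν ≤
          Bandit.instanceBound k T (fun i => Bandit.mean ν (σ i))) ∧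
    (∃ C : ℝ, ∀ (K T : ℕ), 1 ≤ K → K < T →
      ∀ (tieL tieE : Bandit.TieRule K),
      ∀ ν ∈ Bandit.instances K,
        Bandit.regret T (Bandit.adaETC K T tieL tieE) ν ≤
          C * ((K : ℝ) ^ (1 / 3 : ℝ) * (T : ℝ) ^ (2 / 3 : ℝ) * Real.sqrt (Real.log (K : ℝ)))) :=
  ⟨fun _ _ hT tieL tieE _ hν σ hlt hanti =>
      Bandit.regret_le_instanceBound (by omega) tieL tieE hν σ hlt hanti,
    104, fun _ _ hK hKT tieL tieE _ hν => Bandit.regret_le_worstCase hK hKT tieL tieE hν⟩
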